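/- Let $\mathbb{K}\in\{\mathbb{R},\mathbb{C}\}$ and let $X\neq\{0\}$ be a Banach space over $\mathbb{K}$. For a Banach space $Y$ put $\Pi(Y)=\{(y^*,y)\in S_{Y^*}\times S_Y : y^*(y)=1\}$. For a bounded linear operator $T$ on $Y$, the numerical radius is $v(T)=\sup\{|y^*(Ty)| : (y^*,y)\in\Pi(Y)\}$, and $T$ is said to attain its numerical radius if $|y^*(Ty)|=v(T)$ for some $(y^*,y)\in\Pi(Y)$. The numerical index of $X$ is $n(X)=\inf\{v(T) : T\in\mathcal{L}(X),\ \|T\|=1\}$. Assume that $n(X)>0$, so that $v$ is a norm on $\mathcal{L}(X)$ equivalent to the operator norm. Let $\mathcal{L}_v(X)$ denote the space of bounded linear operators on $X$ with the norm $v$, let $\mathcal{K}_v(X)$ denote its closed subspace of compact operators, and let $B_{\mathcal{K}_v(X)}=\{K\in\mathcal{K}_v(X) : v(K)\le 1\}$. For $T\in\mathcal{L}_v(X)$ let $$\rho_v\big(T,B_{\mathcal{K}_v(X)}\big)=\sup\{v(T-K) : K\in B_{\mathcal{K}_v(X)}\},$$ and say that $T$ has a farthest point in $B_{\mathcal{K}_v(X)}$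 if $v(T-K)=\rho_v\big(T,B_{\mathcal{K}_v(X)}\big)$ for some $K\in B_{\mathcal{K}_v(X)}$. A closed subspace $J$ of a normed space $E$ is called an M-ideal in $E$ if $E^*=J^*\oplus_1 J^\perp$, that is, if the annihilator $J^\perp$ is the range of a linear projection $P$ on $E^*$ such that $\|f\|=\|Pf\|+\|f-Pf\|$ for all $f\in E^*$. Then the following hold. 1. For each $T\in\mathcal{L}_v(X)$, $\rho_v\big(T,B_{\mathcal{K}_v(X)}\big)=v(T)+1$. 2. If $T\in\mathcal{L}_v(X)$ attains its numerical radius, then $T$ has a farthest point in $B_{\mathcal{K}_v(X)}$. 3. If $\mathcal{K}_v(X)$ is an M-ideal in $\mathcal{L}_v(X)$ and $T\in\mathcal{L}_v(X)$ has a farthest point in $B_{\mathcal{K}_v(X)}$, then the adjoint $T^*:X^*\to X^*$ attains its numerical radius. -/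

import Mathlib

open Set Metric

noncomputable section

/-! ### Numerical radius, numerical index -/

section NumericalRadius

variable (𝕜 : Type*) [RCLike 𝕜] (X : Type*) [NormedAddCommGroup X] [NormedSpace 𝕜 X]

/-- `Π(X) = {(x*, x) ∈ S_{X*} × S_X : x*(x) = 1}`. -/
def numericalStates : Set (StrongDual 𝕜 X × X) :=
  {p | ‖p.1‖ = 1 ∧ ‖p.2‖ = 1 ∧ p.1 p.2 = 1}

variable {𝕜 X}

/-- The numerical radius `v(T) = sup {|x*(T x)| : (x*, x) ∈ Π(X)}`. -/
def numericalRadius (T : X →L[𝕜] X) : ℝ :=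
  sSup {r : ℝ | ∃ p ∈ numericalStates 𝕜 X, r = ‖p.1 (T p.2)‖}

variable (𝕜 X) in
/-- The numerical index `n(X) = inf {v(T) : ‖T‖ = 1}`. -/
def numericalIndex : ℝ :=
  sInf {r : ℝ | ∃ T : X →L[𝕜] X, ‖T‖ = 1 ∧ r = numericalRadius T}

/-- `T` attains its numerical radius: `|x*(T x)| = v(T)` for some `(x*, x) ∈ Π(X)`. -/
def AttainsNumericalRadius (T : X →L[𝕜] X) : Prop :=
  ∃ p ∈ numericalStates 𝕜 X, ‖p.1 (T p.2)‖ = numericalRadius T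

/-- The Banach space adjoint `T* : X* → X*`, `T* f = f ∘ T`. -/
def banachAdjoint (T : X →L[𝕜] X) : StrongDual 𝕜 X →L[𝕜] StrongDual 𝕜 X :=
  ContinuousLinearMap.precomp 𝕜 T

theorem banachAdjoint_apply (T : X →L[𝕜] X) (f : StrongDual 𝕜 X) (x : X) :
    banachAdjoint T f x = f (T x) := rfl

theorem norm_apply_le_opNorm (T : X →L[𝕜] X) {p : StrongDual 𝕜 X × X}
    (hp : p ∈ numericalStates 𝕜 X) : ‖p.1 (T p.2)‖ ≤ ‖T‖ := by
  obtain ⟨h1, h2, -⟩ := hp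
  calc ‖p.1 (T p.2)‖ ≤ ‖p.1‖ * ‖T p.2‖ := p.1.le_opNorm _
    _ ≤ ‖p.1‖ * (‖T‖ * ‖p.2‖) := by gcongr; exact T.le_opNorm _
    _ = ‖T‖ := by rw [h1, h2]; ring

theorem norm_apply_le_numericalRadius (T : X →L[𝕜] X) {p : StrongDual 𝕜 X × X}
    (hp : p ∈ numericalStates 𝕜 X) : ‖p.1 (T p.2)‖ ≤ numericalRadius T := by
  refine le_csSup ⟨‖T‖, ?_⟩ ⟨p, hp, rfl⟩
  rintro r ⟨q, hq, rfl⟩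
  exact norm_apply_le_opNorm T hq

theorem numericalRadius_nonneg (T : X →L[𝕜] X) : 0 ≤ numericalRadius T := by
  refine Real.sSup_nonneg ?_
  rintro r ⟨p, -, rfl⟩
  exact norm_nonneg _

theorem numericalRadius_le (T : X →L[𝕜] X) {c : ℝ} (hc : 0 ≤ c)
    (h : ∀ p ∈ numericalStates 𝕜 X, ‖p.1 (T p.2)‖ ≤ c) : numericalRadius T ≤ c := by
  refine Real.sSup_le ?_ hc
  rintro r ⟨p, hp, rfl⟩
  exact h p hp

theorem numericalRadius_add_le (S T : X →L[𝕜] X) :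
    numericalRadius (S + T) ≤ numericalRadius S + numericalRadius T := by
  refine numericalRadius_le _ (add_nonneg (numericalRadius_nonneg S) (numericalRadius_nonneg T)) ?_
  intro p hp
  have h : p.1 ((S + T) p.2) = p.1 (S p.2) + p.1 (T p.2) := by simp
  rw [h]
  exact (norm_add_le _ _).trans
    (add_le_add (norm_apply_le_numericalRadius S hp) (norm_apply_le_numericalRadius T hp))

theorem numericalRadius_smul_le (c : 𝕜) (T : X →L[𝕜] X) :
    numericalRadius (c • T) ≤ ‖c‖ * numericalRadius T := by
  refine numericalRadius_le _ (mul_nonneg (norm_nonneg c) (numericalRadius_nonneg T)) ?_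
  intro p hp
  have h : p.1 ((c • T) p.2) = c * p.1 (T p.2) := by simp
  rw [h, norm_mul]
  exact mul_le_mul_of_nonneg_left (norm_apply_le_numericalRadius T hp) (norm_nonneg c)

variable (𝕜 X) in
/-- The numerical radius as a seminorm on `L(X)`. -/
def numericalRadiusSeminorm : Seminorm 𝕜 (X →L[𝕜] X) :=
  Seminorm.ofSMulLE numericalRadius
    (le_antisymm (numericalRadius_le _ le_rfl (fun p _ => by simp)) (numericalRadius_nonneg _))
    numericalRadius_add_le numericalRadius_smul_le

end NumericalRadius

/-! ### The spaces `L_v(X)` and `K_v(X)` -/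

section Lv

variable (𝕜 : Type*) [RCLike 𝕜] (X : Type*) [NormedAddCommGroup X] [NormedSpace 𝕜 X]

/-- `L_v(X)`: the space of bounded operators on `X`, with the numerical radius in place of the
operator norm. In general the numerical radius is only a seminorm; it is a norm equivalent to the
operator norm as soon as `n(X) > 0`, see `NumRadOp.mul_opNorm_le_norm`. -/
def NumRadOp : Type _ := X →L[𝕜] X

namespace NumRadOp

instance : AddCommGroup (NumRadOp 𝕜 X) := inferInstanceAs (AddCommGroup (X →L[𝕜] X))

instance : Module 𝕜 (NumRadOp 𝕜 X) := inferInstanceAs (Module 𝕜 (X →L[𝕜] X))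

/-- The identity map from `L_v(X)` to `L(X)`. -/
def toOp : NumRadOp 𝕜 X ≃ₗ[𝕜] (X →L[𝕜] X) := LinearEquiv.refl 𝕜 (X →L[𝕜] X)

instance : SeminormedAddCommGroup (NumRadOp 𝕜 X) :=
  AddGroupSeminorm.toSeminormedAddCommGroup
    ((numericalRadiusSeminorm 𝕜 X).comp (toOp 𝕜 X).toLinearMap).toAddGroupSeminorm

variable {𝕜 X} in
theorem norm_def (T : NumRadOp 𝕜 X) : ‖T‖ = numericalRadius (toOp 𝕜 X T) := rfl

instance : NormedSpace 𝕜 (NumRadOp 𝕜 X) where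
  norm_smul_le c T := numericalRadius_smul_le c (toOp 𝕜 X T)

/-- `K_v(X)`: the subspace of compact operators in `L_v(X)`. -/
def compactOps : Submodule 𝕜 (NumRadOp 𝕜 X) :=
  (compactOperator (RingHom.id 𝕜) X X).comap (toOp 𝕜 X).toLinearMap

variable {𝕜 X} in
theorem mem_compactOps {T : NumRadOp 𝕜 X} :
    T ∈ compactOps 𝕜 X ↔ IsCompactOperator (toOp 𝕜 X T) := Iff.rfl

variable {𝕜 X} in
theorem norm_le_opNorm (T : NumRadOp 𝕜 X) : ‖T‖ ≤ ‖toOp 𝕜 X T‖ :=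
  numericalRadius_le _ (norm_nonneg _) (fun _ hp => norm_apply_le_opNorm _ hp)

variable {𝕜 X} in
theorem mul_opNorm_le_norm (T : NumRadOp 𝕜 X) :
    numericalIndex 𝕜 X * ‖toOp 𝕜 X T‖ ≤ ‖T‖ := by
  by_cases hT : ‖toOp 𝕜 X T‖ = 0
  · rw [hT, mul_zero]; exact norm_nonneg T
  · have hpos : 0 < ‖toOp 𝕜 X T‖ := lt_of_le_of_ne (norm_nonneg _) (Ne.symm hT)
    set c : 𝕜 := ((‖toOp 𝕜 X T‖⁻¹ : ℝ) : 𝕜) with hc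
    have hcn : ‖c‖ = ‖toOp 𝕜 X T‖⁻¹ := by
      rw [hc, RCLike.norm_ofReal, abs_of_pos (inv_pos.mpr hpos)]
    have h1 : numericalIndex 𝕜 X ≤ numericalRadius (c • toOp 𝕜 X T) := by
      refine csInf_le ⟨0, ?_⟩ ⟨_, ?_, rfl⟩
      · rintro r ⟨S, -, rfl⟩
        exact numericalRadius_nonneg S
      · rw [norm_smul, hcn, inv_mul_cancel₀ hT]
    have h2 := h1.trans (numericalRadius_smul_le c (toOp 𝕜 X T))
    rw [hcn, ← norm_def] at h2
    rwa [← le_div_iff₀ hpos, div_eq_inv_mul]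

end NumRadOp

end Lv

/-! ### M-ideals -/

section MIdeal

variable {𝕜 : Type*} [RCLike 𝕜] {E : Type*} [SeminormedAddCommGroup E] [NormedSpace 𝕜 E]

/-- The annihilator `J^⊥ = {f ∈ E* : f = 0 on J}`. -/
def annihilatorInDual (J : Submodule 𝕜 E) : Submodule 𝕜 (StrongDual 𝕜 E) where
  carrier := {f | ∀ x ∈ J, f x = 0}
  add_mem' {f g} hf hg x hx := by
    have h : (f + g) x = f x + g x := rfl
    rw [h, hf x hx, hg x hx, add_zero]
  zero_mem' _ _ := rfl
  smul_mem' c f hf x hx := by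
    have h : (c • f) x = c • f x := rfl
    rw [h, hf x hx, smul_zero]

/-- `P` is an L-projection of the dual `E*`: a linear projection with `‖f‖ = ‖P f‖ + ‖f - P f‖`
for all `f`. (Mathlib's `IsLprojection` asks for a `NormedAddCommGroup` instance, which the dual of
a seminormed space does not carry; the two conditions are the same.) -/
structure IsDualLProjection (P : StrongDual 𝕜 E →L[𝕜] StrongDual 𝕜 E) : Prop where
  proj : ∀ f, P (P f) = P f
  norm_eq : ∀ f, ‖f‖ = ‖P f‖ + ‖f - P f‖

/-- A closed subspace `J` of `E` is an M-ideal if `J^⊥` is an L-summand of `E*`, that is, the range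
of an L-projection `P`. The complementary summand (the kernel of `P`) is then isometric to `J*` by
restriction, which is the meaning of `E* = J* ⊕₁ J^⊥`. -/
def IsMIdeal (J : Submodule 𝕜 E) : Prop :=
  IsClosed (J : Set E) ∧
    ∃ P : StrongDual 𝕜 E →L[𝕜] StrongDual 𝕜 E,
      IsDualLProjection P ∧ LinearMap.range P.toLinearMap = annihilatorInDual J

end MIdeal

/-! ### Farthest points -/

section Farthest

variable {E : Type*} [SeminormedAddCommGroup E]

/-- The farthest distance `ρ(x, C) = sup {‖x - z‖ : z ∈ C}`. -/
def farthestDist (x : E) (C : Set E) : ℝ := sSup {r : ℝ | ∃ z ∈ C, r = ‖x - z‖}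

/-- `x` has a farthest point in `C`. -/
def HasFarthestPoint (x : E) (C : Set E) : Prop := ∃ y ∈ C, ‖x - y‖ = farthestDist x C

end Farthest

/-- The closed unit ball `B_{K_v(X)}` of `K_v(X)`, as a subset of `L_v(X)`. -/
def compactOpsUnitBall (𝕜 : Type*) [RCLike 𝕜] (X : Type*) [NormedAddCommGroup X]
    [NormedSpace 𝕜 X] : Set (NumRadOp 𝕜 X) :=
  {K | K ∈ NumRadOp.compactOps 𝕜 X ∧ ‖K‖ ≤ 1}

end

/-!
For a state `(x*, x)` and a unimodular `c`, the rank-one operator `K = -c x* ⊗ x` has numerical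
radius at most `1` and `x*((T - K) x) = x*(T x) + c`. Choosing `c` in the direction of `x*(T x)`
gives `‖T - K‖ ≥ |x*(T x)| + 1`, whence the first two assertions.

For the third, let `K` be a farthest point of `T`. States of `X` along which `|x*((T - K) x)|`
tends to `v(T) + 1` converge, along an ultrafilter, to a functional `φ` on `L_v(X)` with `φ(1) =
1`, `|φ(T)| = v(T)` and `|φ(K)| = 1`. On the compact operators `φ` is `S ↦ x**(S* x*)`, where `x*`
and `x**` are the weak-star limits of the states. Let `P` be the L-projection onto the annihilator
of the compact operators. Since `P φ` vanishes at `K`, the norm of `φ - P φ` is at least one, so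
`P φ = 0`. If `x**(x*) = 1`, then `S ↦ x**(S* x*)` is a norm-one functional with the same values
on the compact operators, so it is equal to `φ`, and `T*` attains its numerical radius at `(x**,
x*)`.

What has to be shown is thus `x**(x*) = 1`, which is not clear because the pairing is not jointly
weak-star continuous. Let `M : X* → X***` be given by `(M x*)(x**) = (ψ - P ψ)(1)` with `ψ(S) =
x**(S* x*)` (`NumRadOp.compactPartAtOne`). For the limit pair `(M x*)(x**) = φ(1) = 1`, so it
suffices that `M` is the canonical embedding (`NumRadOp.compactPartAtOne_eq_inclusion`).

* If a state of `L_v(X)` is given by `(x*, x**)` on the compact operators, then `(M x*)(x**)` is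
  the norm of its compact part, hence at least `‖x*‖ ‖x**‖`: the compact part is tested on
  rank-one operators (`NumRadOp.norm_mul_norm_le_re_compactPartAtOne`). This applies to states of
  `X` and, by Lumer's theorem, to states of `X**`. By the Bishop–Phelps theorem
  (`exists_normAttaining_near`), such inequalities on states become norm inequalities on all of
  `X*` and `X***`.
* Write `p : X*** → X*` for the restriction and `Z = 1 - p M`. The norm inequalities say that `±Z`
  are accretive and that the flow `y' = -M p y` on `X***` diminishes the norm at rate `‖p y‖`. As
  `‖p y‖` decays like `e^{-t}`, the flow diminishes the norm by `‖p y‖` in total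
  (`norm_sub_add_norm_le_of_accretive`). Started in `X*`, it must therefore end at `0`, which
  yields that `M` takes values in `X*`; started elsewhere, it yields `X*** = X* ⊕₁ X^⊥`.
* The operator `Z**` generates isometries of `X***`, and these respect the decomposition
  (`apply_eq_zero_of_lsum`). So `Z**` leaves `X^⊥` invariant, which means that `Z*` leaves `X`
  invariant. The restriction of `Z*` to `X` has numerical radius zero, and `n(X) > 0` gives `Z =
  0`.
-/

noncomputable section

open Filter Topology

-- The instances on the triple dual `X***` are found only with a larger depth.
set_option maxSynthPendingDepth 3

/-! ### Norm-attaining functionals are dense -/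

/-- A weak form of Ekeland's variational principle: a nonnegative continuous function on a complete
metric space has a point `z` from which it nowhere descends with slope more than `ε`, and `z` can be
reached from a given point `y` by descending at least with slope `ε`. -/
theorem exists_ekeland_point {Y : Type*} [MetricSpace Y] [CompleteSpace Y] {ψ : Y → ℝ}
    (hψ : Continuous ψ) (h0 : ∀ x, 0 ≤ ψ x) {ε : ℝ} (hε : 0 < ε) (y : Y) :
    ∃ z, ψ z + ε * dist z y ≤ ψ y ∧ ∀ x, ψ z ≤ ψ x + ε * dist x z := by
  have trans_le : ∀ {a b c : Y}, ψ a + ε * dist a b ≤ ψ b → ψ b + ε * dist b c ≤ ψ c →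
      ψ a + ε * dist a c ≤ ψ c := by
    intro a b c hab hbc
    have := mul_le_mul_of_nonneg_left (dist_triangle a b c) hε.le
    linarith
  -- From each point descend to a point whose value is almost the least that can be reached.
  have step : ∀ (n : ℕ) (x : Y), ∃ x', ψ x' + ε * dist x' x ≤ ψ x ∧
      ∀ w, ψ w + ε * dist w x ≤ ψ x → ψ x' ≤ ψ w + (1 / 2) ^ n := by
    intro n x
    set V : Set ℝ := ψ '' {w | ψ w + ε * dist w x ≤ ψ x} with hV
    have hne : V.Nonempty := ⟨ψ x, x, by simp, rfl⟩
    have hbdd : BddBelow V := ⟨0, by rintro _ ⟨w, -, rfl⟩; exact h0 w⟩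
    obtain ⟨_, ⟨x', hx', rfl⟩, hlt⟩ :=
      Real.lt_sInf_add_pos hne (show (0 : ℝ) < (1 / 2) ^ n by positivity)
    exact ⟨x', hx', fun w hw => by linarith [csInf_le hbdd ⟨w, hw, rfl⟩]⟩
  choose next hnext hmin using step
  let u : ℕ → Y := fun n => Nat.rec y (fun n x => next n x) n
  have hu : ∀ n, u (n + 1) = next n (u n) := fun n => rfl
  have hdesc : ∀ n k, ψ (u (n + k)) + ε * dist (u (n + k)) (u n) ≤ ψ (u n) := by
    intro n k
    induction k with
    | zero => simp
    | succ k ih => exact trans_le (by rw [← add_assoc, hu]; exact hnext _ _) ih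
  have hsmall : ∀ n w, ψ w + ε * dist w (u (n + 1)) ≤ ψ (u (n + 1)) →
      dist w (u (n + 1)) ≤ 1 / ε * (1 / 2) ^ n := by
    intro n w hw
    have h1 := hmin n (u n) w (trans_le hw (by rw [hu]; exact hnext _ _))
    rw [← hu] at h1
    rw [one_div_mul_eq_div, le_div_iff₀ hε]
    linarith
  have hcauchy : CauchySeq fun n => u (n + 1) := by
    refine cauchySeq_of_le_geometric (1 / 2) (1 / ε) (by norm_num) fun n => ?_
    rw [dist_comm]
    exact hsmall n _ (hdesc (n + 1) 1)
  obtain ⟨z, hz'⟩ := cauchySeq_tendsto_of_complete hcauchy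
  have hz : Tendsto u atTop (𝓝 z) := (tendsto_add_atTop_iff_nat 1).mp hz'
  have hzn : ∀ n, ψ z + ε * dist z (u n) ≤ ψ (u n) := by
    intro n
    have hlim : Tendsto (fun k => ψ (u k) + ε * dist (u k) (u n)) atTop
        (𝓝 (ψ z + ε * dist z (u n))) :=
      ((hψ.tendsto z).comp hz).add ((hz.dist tendsto_const_nhds).const_mul ε)
    refine le_of_tendsto hlim (eventually_atTop.mpr ⟨n, fun k hk => ?_⟩)
    obtain ⟨j, rfl⟩ := Nat.exists_eq_add_of_le hk
    exact hdesc n j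
  refine ⟨z, hzn 0, fun x => ?_⟩
  by_contra! hlt
  have hx : ∀ n, dist x (u (n + 1)) ≤ 1 / ε * (1 / 2) ^ n :=
    fun n => hsmall n x (trans_le hlt.le (hzn (n + 1)))
  have hgeom : Tendsto (fun n : ℕ => 1 / ε * (1 / 2 : ℝ) ^ n) atTop (𝓝 0) := by
    simpa using (tendsto_pow_atTop_nhds_zero_of_lt_one (r := (1 / 2 : ℝ)) (by norm_num)
      (by norm_num)).const_mul (1 / ε)
  have hxz : dist x z ≤ 0 := le_of_tendsto_of_tendsto' (tendsto_const_nhds.dist hz') hgeom hx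
  rw [dist_le_zero.mp hxz] at hlt
  simp at hlt

/-- The Bishop–Phelps theorem for a real Banach space. -/
theorem exists_normAttaining_near_real {Y : Type*} [NormedAddCommGroup Y] [NormedSpace ℝ Y]
    [CompleteSpace Y] [Nontrivial Y] (h : StrongDual ℝ Y) {ε : ℝ} (hε : 0 < ε) :
    ∃ (g : StrongDual ℝ Y) (z : Y), ‖z‖ = 1 ∧ ‖g - h‖ ≤ ε ∧ g z = ‖g‖ := by
  rcases eq_or_ne h 0 with rfl | hh
  · obtain ⟨z, hz⟩ := exists_norm_eq Y zero_le_one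
    exact ⟨0, z, hz, by simpa using hε.le, by simp⟩
  set r := ‖h‖ with hr
  have hr0 : 0 < r := norm_pos_iff.mpr hh
  obtain ⟨δ, hδ0, hδr, hδε⟩ : ∃ δ, 0 < δ ∧ δ ≤ r / 2 ∧ δ ≤ ε / 2 :=
    ⟨min (r / 2) (ε / 2), by positivity, min_le_left _ _, min_le_right _ _⟩
  obtain ⟨y, hy1, hy⟩ : ∃ y : Y, ‖y‖ ≤ 1 ∧ r - δ < h y := by
    obtain ⟨y, hy1, hy⟩ := h.exists_lt_apply_of_lt_opNorm (show r - δ < ‖h‖ by linarith)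
    rcases le_total 0 (h y) with h1 | h1
    · exact ⟨y, hy1.le, by rwa [Real.norm_of_nonneg h1] at hy⟩
    · exact ⟨-y, by simpa using hy1.le, by rwa [Real.norm_of_nonpos h1, ← map_neg] at hy⟩
  have hle : ∀ x, h x ≤ r * ‖x‖ := fun x => (le_abs_self _).trans (h.le_opNorm x)
  obtain ⟨z, hzy, hz⟩ := exists_ekeland_point (ψ := fun x => r * ‖x‖ - h x) (by fun_prop)
    (fun x => sub_nonneg.mpr (hle x)) hε y
  have hz0 : z ≠ 0 := by
    rintro rfl
    have h1 : r * ‖y‖ ≤ r := by nlinarith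
    have h2 := hle y
    simp only [norm_zero, map_zero, dist_zero_left] at hzy
    nlinarith
  have hek : ∀ k, h k ≤ r * ‖z + k‖ - r * ‖z‖ + ε * ‖k‖ := by
    intro k
    have := hz (z + k)
    simp only [map_add, dist_self_add_left] at this
    linarith
  -- `h = ℓ + m` with `ℓ` norming `z` and `m` of norm at most `ε`: extend the obvious functional
  -- from the subspace `{(s z + k, k)}` of `Y × Y` under the norm `r ‖a‖ + ε ‖b‖`.
  let j : ℝ × Y →ₗ[ℝ] Y × Y :=
    { toFun := fun q => (q.1 • z + q.2, q.2)
      map_add' := fun q q' => by ext <;> simp [add_smul]; abel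
      map_smul' := fun c q => by ext <;> simp [mul_smul] }
  have hj : Function.Injective j := by
    rw [injective_iff_map_eq_zero]
    rintro ⟨s, k⟩ hsk
    have h2 : k = 0 := congrArg Prod.snd hsk
    have h1 : s • z + k = 0 := congrArg Prod.fst hsk
    rw [h2, add_zero, smul_eq_zero] at h1
    simp [h2, h1.resolve_right hz0]
  let F : ℝ × Y →ₗ[ℝ] ℝ :=
    (LinearMap.toSpanSingleton ℝ ℝ (r * ‖z‖)).coprod h.toLinearMap
  have hF : ∀ q, F q = q.1 * (r * ‖z‖) + h q.2 := fun q => by simp [F]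
  let e := LinearEquiv.ofInjective j hj
  obtain ⟨G, hG, hGN⟩ := exists_extension_of_le_sublinear
    ⟨LinearMap.range j, F.comp e.symm.toLinearMap⟩ (fun q : Y × Y => r * ‖q.1‖ + ε * ‖q.2‖)
    (fun c hc q => by simp [norm_smul, abs_of_pos hc]; ring)
    (fun q q' => by
      have h1 := mul_le_mul_of_nonneg_left (norm_add_le q.1 q'.1) hr0.le
      have h2 := mul_le_mul_of_nonneg_left (norm_add_le q.2 q'.2) hε.le
      simp only [Prod.fst_add, Prod.snd_add]
      linarith)
    (by
      rintro ⟨_, ⟨s, k⟩, rfl⟩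
      have he : e.symm ⟨j (s, k), ⟨(s, k), rfl⟩⟩ = (s, k) := e.symm_apply_apply (s, k)
      change F (e.symm ⟨j (s, k), ⟨(s, k), rfl⟩⟩) ≤ r * ‖s • z + k‖ + ε * ‖k‖
      rw [he, hF]
      rcases lt_trichotomy s 0 with hs | rfl | hs
      · have h1 : ‖k‖ ≤ ‖s • z + k‖ + ‖s • z‖ := by
          simpa using norm_sub_le (s • z + k) (s • z)
        rw [norm_smul, Real.norm_of_nonpos hs.le] at h1
        have h2 := mul_le_mul_of_nonneg_left h1 hr0.le
        have h3 := hle k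
        have h4 : 0 ≤ ε * ‖k‖ := by positivity
        simp only
        nlinarith
      · have h3 := hle k
        have h4 : 0 ≤ ε * ‖k‖ := by positivity
        simp only [zero_mul, zero_smul, zero_add]
        linarith
      · have h1 := mul_le_mul_of_nonneg_left (hek (s⁻¹ • k)) hs.le
        have h2 : ‖s • z + k‖ = s * ‖z + s⁻¹ • k‖ := by
          rw [← abs_of_pos hs, ← Real.norm_eq_abs, ← norm_smul, smul_add, Real.norm_eq_abs,
            abs_of_pos hs, smul_inv_smul₀ hs.ne']
        rw [map_smul, norm_smul, norm_inv, Real.norm_of_nonneg hs.le, smul_eq_mul] at h1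
        rw [h2]
        have h3 : s * (s⁻¹ * h k) = h k := mul_inv_cancel_left₀ hs.ne' _
        have h4 : s * (ε * (s⁻¹ * ‖k‖)) = ε * ‖k‖ := by field_simp
        simp only at h1 ⊢
        linarith)
  have hGj : ∀ s k, G (s • z + k, k) = s * (r * ‖z‖) + h k := by
    intro s k
    have h1 := hG ⟨j (s, k), ⟨(s, k), rfl⟩⟩
    change G (s • z + k, k) = F (e.symm ⟨j (s, k), ⟨(s, k), rfl⟩⟩) at h1
    have he : e.symm ⟨j (s, k), ⟨(s, k), rfl⟩⟩ = (s, k) := e.symm_apply_apply (s, k)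
    rw [h1, he, hF]
  let g : StrongDual ℝ Y := (G.comp (LinearMap.inl ℝ Y Y)).mkContinuous r fun x => by
    rw [Real.norm_eq_abs, abs_le']
    have h1 := hGN (x, 0)
    have h2 := hGN (-(x, 0))
    rw [map_neg] at h2
    simp at h1 h2
    simpa using ⟨h1, h2⟩
  have hg : ∀ x, g x = G (x, 0) := fun x => rfl
  have hgz : g z = r * ‖z‖ := by simpa [hg] using hGj 1 0
  have hgr : ‖g‖ ≤ r := LinearMap.mkContinuous_norm_le _ hr0.le _
  have hz1 : 0 < ‖z‖ := norm_pos_iff.mpr hz0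
  have hgr' : ‖g‖ = r := by
    refine le_antisymm hgr (le_of_mul_le_mul_right ?_ hz1)
    rw [← hgz]
    exact (le_abs_self _).trans (g.le_opNorm z)
  refine ⟨g, ‖z‖⁻¹ • z, by rw [norm_smul, norm_inv, norm_norm, inv_mul_cancel₀ hz1.ne'], ?_, ?_⟩
  · refine ContinuousLinearMap.opNorm_le_bound _ hε.le fun k => ?_
    have h1 : (g - h) k = -G (0, k) := by
      have h2 := hGj 0 k
      have h3 : G (k, k) = G (k, 0) + G (0, k) := by rw [← map_add]; simp
      simp only [zero_smul, zero_add, zero_mul] at h2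
      rw [_root_.sub_apply, hg]
      linarith
    rw [h1, norm_neg, Real.norm_eq_abs, abs_le']
    have h4 := hGN (0, k)
    have h5 := hGN (-(0, k))
    rw [map_neg] at h5
    simp at h4 h5
    exact ⟨h4, h5⟩
  · rw [map_smul, hgz, hgr', smul_eq_mul]
    field_simp

/-- The Bishop–Phelps theorem: the norm-attaining functionals on a Banach space are dense in its
dual. -/
theorem exists_normAttaining_near {𝕜 : Type*} [RCLike 𝕜] {Y : Type*} [NormedAddCommGroup Y]
    [NormedSpace 𝕜 Y] [CompleteSpace Y] [Nontrivial Y] (h : StrongDual 𝕜 Y) {ε : ℝ} (hε : 0 < ε) :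
    ∃ (g : StrongDual 𝕜 Y) (z : Y), ‖z‖ = 1 ∧ ‖g - h‖ ≤ ε ∧ g z = (‖g‖ : 𝕜) := by
  let : NormedSpace ℝ Y := NormedSpace.restrictScalars ℝ 𝕜 Y
  have : IsScalarTower ℝ 𝕜 Y := .restrictScalars _ _ _
  let Φ := StrongDual.extendRCLikeₗᵢ (𝕜 := 𝕜) (F := Y)
  obtain ⟨g, z, hz, hgh, hgz⟩ := exists_normAttaining_near_real (Φ.symm h) hε
  refine ⟨Φ g, z, hz, ?_, ?_⟩
  · rwa [← Φ.symm.norm_map, map_sub, Φ.symm_apply_apply]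
  · have hre : RCLike.re (Φ g z) = ‖Φ g‖ := by
      rw [Φ.norm_map, ← hgz]
      exact StrongDual.re_extendRCLike_apply g z
    have hle : ‖Φ g z‖ ≤ ‖Φ g‖ := by simpa [hz] using (Φ g).le_opNorm z
    have h1 : RCLike.re (Φ g z) = ‖Φ g z‖ :=
      le_antisymm (RCLike.re_le_norm _) (by rwa [hre])
    rw [← hre, RCLike.re_eq_self_of_le h1.ge]

/-! ### Flows of accretive operators -/

section Accretive

variable {E F : Type*} [NormedAddCommGroup E] [NormedSpace ℝ E] [NormedAddCommGroup F]
  [NormedSpace ℝ F]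

/-- If `±Z` are both accretive, then `1 + s Z` is an isometry to first order in `s`. -/
theorem norm_add_smul_le_of_accretive {Z : E →L[ℝ] E}
    (hZ : ∀ (e : E) (s : ℝ), ‖e‖ ≤ ‖e + s • Z e‖) (e : E) (s : ℝ) :
    ‖e + s • Z e‖ ≤ (1 + ‖Z‖ ^ 2 * s ^ 2) * ‖e‖ := by
  have h1 := hZ (e + s • Z e) (-s)
  have h2 : e + s • Z e + (-s) • Z (e + s • Z e) = e - s ^ 2 • Z (Z e) := by
    simp only [map_add, map_smul]
    module
  have h3 : ‖Z (Z e)‖ ≤ ‖Z‖ ^ 2 * ‖e‖ :=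
    calc ‖Z (Z e)‖ ≤ ‖Z‖ * (‖Z‖ * ‖e‖) := Z.le_opNorm_of_le (Z.le_opNorm e)
      _ = ‖Z‖ ^ 2 * ‖e‖ := by ring
  have h4 : ‖e - s ^ 2 • Z (Z e)‖ ≤ ‖e‖ + s ^ 2 * (‖Z‖ ^ 2 * ‖e‖) := by
    refine (norm_sub_le _ _).trans ?_
    rw [norm_smul, Real.norm_of_nonneg (sq_nonneg s)]
    gcongr
  rw [h2] at h1
  linarith

variable {Z : E →L[ℝ] E}

theorem le_norm_sub_smul_of_accretive (hZ : ∀ (e : E) (s : ℝ), ‖e‖ ≤ ‖e + s • Z e‖)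
    {t : ℝ} (ht : t < 1) (e : E) : (1 - t) * ‖e‖ ≤ ‖e - t • (e - Z e)‖ := by
  have ht' : 0 < 1 - t := by linarith
  have h1 : e - t • (e - Z e) = (1 - t) • (e + (t / (1 - t)) • Z e) := by
    rw [smul_add, smul_smul, mul_div_cancel₀ _ ht'.ne']
    module
  rw [h1, norm_smul, Real.norm_of_nonneg ht'.le]
  exact mul_le_mul_of_nonneg_left (hZ _ _) ht'.le

theorem norm_sub_smul_le_of_accretive (hZ : ∀ (e : E) (s : ℝ), ‖e‖ ≤ ‖e + s • Z e‖)
    {t : ℝ} (ht0 : 0 ≤ t) (ht : t ≤ 1 / 2) (htZ : ‖Z‖ ^ 2 * t ≤ 1 / 8) (e : E) :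
    ‖e - t • (e - Z e)‖ ≤ (1 - t / 2) * ‖e‖ := by
  have ht' : 0 < 1 - t := by linarith
  have h1 : e - t • (e - Z e) = (1 - t) • (e + (t / (1 - t)) • Z e) := by
    rw [smul_add, smul_smul, mul_div_cancel₀ _ ht'.ne']
    module
  rw [h1, norm_smul, Real.norm_of_nonneg ht'.le]
  have h2 := norm_add_smul_le_of_accretive hZ e (t / (1 - t))
  have h3 : (1 - t) * (1 + ‖Z‖ ^ 2 * (t / (1 - t)) ^ 2) ≤ 1 - t / 2 := by
    have h4 : (1 - t) * (1 + ‖Z‖ ^ 2 * (t / (1 - t)) ^ 2)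
        = 1 - t + (‖Z‖ ^ 2 * t) * (t / (1 - t)) := by field_simp
    have h5 : t / (1 - t) ≤ 2 * t := by
      rw [div_le_iff₀ ht']
      nlinarith
    have h6 : (‖Z‖ ^ 2 * t) * (t / (1 - t)) ≤ 1 / 8 * (2 * t) := by gcongr
    rw [h4]
    linarith
  calc (1 - t) * ‖e + (t / (1 - t)) • Z e‖
      ≤ (1 - t) * ((1 + ‖Z‖ ^ 2 * (t / (1 - t)) ^ 2) * ‖e‖) := by gcongr
    _ = ((1 - t) * (1 + ‖Z‖ ^ 2 * (t / (1 - t)) ^ 2)) * ‖e‖ := by ring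
    _ ≤ (1 - t / 2) * ‖e‖ := by gcongr

/-- `1 - Z` is onto when `±Z` are accretive. -/
theorem exists_sub_eq_of_accretive [CompleteSpace E]
    (hZ : ∀ (e : E) (s : ℝ), ‖e‖ ≤ ‖e + s • Z e‖) (e : E) : ∃ w, w - Z w = e := by
  obtain ⟨t, ht0, ht, htZ⟩ : ∃ t : ℝ, 0 < t ∧ t ≤ 1 / 2 ∧ ‖Z‖ ^ 2 * t ≤ 1 / 8 := by
    refine ⟨min (1 / 2) (1 / (8 * (‖Z‖ ^ 2 + 1))), by positivity, min_le_left _ _, ?_⟩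
    calc ‖Z‖ ^ 2 * min (1 / 2) (1 / (8 * (‖Z‖ ^ 2 + 1)))
        ≤ ‖Z‖ ^ 2 * (1 / (8 * (‖Z‖ ^ 2 + 1))) := by gcongr; exact min_le_right _ _
      _ ≤ 1 / 8 := by
        rw [mul_one_div, div_le_div_iff₀ (by positivity) (by norm_num)]
        linarith
  let U : E →L[ℝ] E := 1 - t • (1 - Z)
  have hU : ‖U‖ < 1 := by
    refine lt_of_le_of_lt (ContinuousLinearMap.opNorm_le_bound _ (by linarith)
      (norm_sub_smul_le_of_accretive hZ ht0.le ht htZ)) (by linarith)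
  let V := Units.oneSub U hU
  refine ⟨t • (↑V⁻¹ : E →L[ℝ] E) e, ?_⟩
  have h1 : (V : E →L[ℝ] E) ((↑V⁻¹ : E →L[ℝ] E) e) = e := by
    rw [← mul_apply_eq_comp, Units.mul_inv, one_apply_eq_self]
  have h2 : ∀ x, (V : E →L[ℝ] E) x = t • (x - Z x) := by
    intro x
    simp [V, U]
  rw [h2] at h1
  rwa [map_smul, ← smul_sub]

/-- Let `M : E → F` and `p : F → E` be such that `M p` is accretive with excess `‖p ·‖`, and let
`p M = 1 - Z` where `±Z` are accretive. The flow `y' = -M p y` contracts the norm at rate `‖p y‖`,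
while `‖p y‖` decays exactly like `e^{-t}`: so it uses up `‖p y‖` of the norm of `y` before it
reaches its limit `y - M w`, where `p y = p M w`. -/
theorem norm_sub_add_norm_le_of_accretive {M : E →L[ℝ] F} {p : F →L[ℝ] E}
    (hA : ∀ (y : F) (s : ℝ), 0 ≤ s → ‖y‖ + s * ‖p y‖ ≤ ‖y + s • M (p y)‖)
    (hM : ∀ e, p (M e) = e - Z e) (hZ : ∀ (e : E) (s : ℝ), ‖e‖ ≤ ‖e + s • Z e‖)
    {y : F} {w : E} (hyw : p y = w - Z w) : ‖y - M w‖ + ‖p y‖ ≤ ‖y‖ := by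
  set C := ‖M‖ * ‖p.comp M‖ + 1 with hC
  have hC0 : 0 < C := by positivity
  -- The bound up to an error of order `t` comes from Euler's method with step size `t`.
  have key : ∀ t : ℝ, 0 < t → t ≤ 1 / 2 → ‖Z‖ ^ 2 * t ≤ 1 / 8 →
      ‖y - M w‖ + ‖p y‖ ≤ ‖y‖ + 2 * t * C * ‖p y‖ := by
    intro t ht0 ht htZ
    let U : E →L[ℝ] E := 1 - t • (1 - Z)
    have hU : ∀ e, U e = e - t • (e - Z e) := fun e => rfl
    have hUle : ∀ e, ‖U e‖ ≤ (1 - t / 2) * ‖e‖ := norm_sub_smul_le_of_accretive hZ ht0.le ht htZ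
    have hUge : ∀ e, (1 - t) * ‖e‖ ≤ ‖U e‖ := le_norm_sub_smul_of_accretive hZ (by linarith)
    let Ψ : F → ℝ := fun x => ‖x‖ - ‖p x‖ + 2 * t * C * ‖p x‖
    have hstep : ∀ x, Ψ (x - t • M (p x)) ≤ Ψ x := by
      intro x
      set x' := x - t • M (p x) with hx'
      have hpx' : p x' = U (p x) := by rw [hx', map_sub, map_smul, hM, hU]
      have h1 := hA x' t ht0.le
      have h2 : x' + t • M (p x') = x - t ^ 2 • M (p (M (p x))) := by
        rw [hpx', hU, hM, hx']
        simp only [map_sub, map_smul]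
        module
      have h3 : ‖x - t ^ 2 • M (p (M (p x)))‖ ≤ ‖x‖ + t ^ 2 * ((C - 1) * ‖p x‖) := by
        refine (norm_sub_le _ _).trans ?_
        rw [norm_smul, Real.norm_of_nonneg (sq_nonneg t)]
        gcongr
        calc ‖M (p (M (p x)))‖ ≤ ‖M‖ * (‖p.comp M‖ * ‖p x‖) :=
              M.le_opNorm_of_le ((p.comp M).le_opNorm (p x))
          _ = (C - 1) * ‖p x‖ := by rw [hC]; ring
      rw [h2] at h1
      have h4 : (1 - t) * ‖p x‖ ≤ ‖p x'‖ := hpx' ▸ hUge (p x)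
      have h5 : ‖p x'‖ ≤ (1 - t / 2) * ‖p x‖ := hpx' ▸ hUle (p x)
      have h6 : (1 + t) * ((1 - t) * ‖p x‖) ≤ (1 + t) * ‖p x'‖ := by gcongr
      have h7 : 2 * t * C * ‖p x'‖ ≤ 2 * t * C * ((1 - t / 2) * ‖p x‖) := by gcongr
      change ‖x'‖ - ‖p x'‖ + 2 * t * C * ‖p x'‖ ≤ ‖x‖ - ‖p x‖ + 2 * t * C * ‖p x‖
      linarith
    have hiter : ∀ n : ℕ, p (y - M w + M ((U ^ n) w)) = (U ^ n) w - Z ((U ^ n) w) := by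
      intro n
      rw [map_add, map_sub, hM, hM, hyw, sub_self, zero_add]
    have hΨ : ∀ n : ℕ, Ψ (y - M w + M ((U ^ n) w)) ≤ Ψ y := by
      intro n
      induction n with
      | zero => simp
      | succ n ih =>
        refine le_trans (le_of_eq ?_) ((hstep _).trans ih)
        rw [hiter, pow_succ', mul_apply_eq_comp, hU, map_sub, map_smul]
        congr 1
        module
    have hlim : Tendsto (fun n : ℕ => (U ^ n) w) atTop (𝓝 0) := by
      refine squeeze_zero_norm (a := fun n => (1 - t / 2) ^ n * ‖w‖) (fun n => ?_) ?_
      · induction n with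
        | zero => simp
        | succ n ih =>
          rw [pow_succ', mul_apply_eq_comp, pow_succ', mul_assoc]
          exact (hUle _).trans (mul_le_mul_of_nonneg_left ih (by linarith))
      · simpa using (tendsto_pow_atTop_nhds_zero_of_lt_one (r := 1 - t / 2) (by linarith)
          (by linarith)).mul_const ‖w‖
    have hΨc : Continuous Ψ := by fun_prop
    have hlim' : Tendsto (fun n : ℕ => Ψ (y - M w + M ((U ^ n) w))) atTop (𝓝 (Ψ (y - M w))) := by
      have h1 := ((M.continuous.tendsto 0).comp hlim).const_add (y - M w)
      rw [map_zero, add_zero] at h1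
      exact (hΨc.tendsto _).comp h1
    have h1 := le_of_tendsto' hlim' hΨ
    have h2 : p (y - M w) = 0 := by rw [map_sub, hM, hyw, sub_self]
    simp only [Ψ, h2, norm_zero, mul_zero, sub_zero, add_zero] at h1
    linarith
  have hev : ∀ᶠ t in 𝓝[>] (0 : ℝ), ‖y - M w‖ + ‖p y‖ ≤ ‖y‖ + 2 * t * C * ‖p y‖ := by
    have h1 : ∀ᶠ t in 𝓝[>] (0 : ℝ), t < 1 / 2 :=
      nhdsWithin_le_nhds (eventually_lt_nhds (by norm_num))
    have h2 : ∀ᶠ t in 𝓝[>] (0 : ℝ), ‖Z‖ ^ 2 * t < 1 / 8 := by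
      have : Tendsto (fun t : ℝ => ‖Z‖ ^ 2 * t) (𝓝 0) (𝓝 (‖Z‖ ^ 2 * 0)) :=
        (continuous_const_mul _).tendsto 0
      rw [mul_zero] at this
      exact nhdsWithin_le_nhds (this.eventually_lt_const (by norm_num))
    filter_upwards [h1, h2, self_mem_nhdsWithin] with t ht htZ ht0
    exact key t ht0 ht.le htZ.le
  have hlim : Tendsto (fun t : ℝ => ‖y‖ + 2 * t * C * ‖p y‖) (𝓝[>] 0) (𝓝 ‖y‖) := by
    have : Continuous fun t : ℝ => ‖y‖ + 2 * t * C * ‖p y‖ := by fun_prop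
    simpa using (this.tendsto 0).mono_left nhdsWithin_le_nhds
  exact ge_of_tendsto hlim hev

/-- Let `F` be the `ℓ₁`-sum of `ι E` and `ker p`, and let `W` be an operator on `F` for which
`1 + s W` is an isometry to first order in `s`. Then `W` leaves `ker p` invariant. -/
theorem apply_eq_zero_of_lsum {ι : E →L[ℝ] F} {p : F →L[ℝ] E} {W : F →L[ℝ] F}
    (hpι : ∀ e, p (ι e) = e)  (hsum : ∀ y, ‖y - ι (p y)‖ + ‖p y‖ ≤ ‖y‖) {c : ℝ} (hc : 0 ≤ c)
    (hW : ∀ (y : F) (s : ℝ), ‖y + s • W y‖ ≤ (1 + c * s ^ 2) * ‖y‖)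
    {ν : F} (hν : p ν = 0) : p (W ν) = 0 := by
  set k := p (W ν) with hk
  set Q := W ν - ι k with hQ
  have hpQ : p Q = 0 := by rw [hQ, map_sub, hpι, ← hk, sub_self]
  have key : ∀ s : ℝ, 0 < s → s ≤ 1 → 2 * ‖k‖ ≤ s * ((2 * c + c ^ 2) * ‖ν‖ + ‖W Q‖) := by
    intro s hs0 hs1
    have h1 : ‖ν + s • Q‖ + s * ‖k‖ ≤ (1 + c * s ^ 2) * ‖ν‖ := by
      refine le_trans (le_of_eq ?_) ((hsum (ν + s • W ν)).trans (hW ν s))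
      rw [map_add, map_smul, hν, zero_add, ← hk, norm_smul, Real.norm_of_nonneg hs0.le, hQ,
        map_smul]
      congr 2
      module
    have h2 : ‖ν‖ + s * ‖k‖ ≤ (1 + c * s ^ 2) * ‖ν + s • Q‖ + s ^ 2 * ‖W Q‖ := by
      have h3 := hsum (ν - s • ι k)
      rw [map_sub, map_smul, hν, hpι, zero_sub, norm_neg, norm_smul, Real.norm_of_nonneg hs0.le,
        map_neg, map_smul, sub_neg_eq_add, sub_add_cancel] at h3
      have h4 : ν - s • ι k = (ν + s • Q + (-s) • W (ν + s • Q)) + s ^ 2 • W Q := by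
        rw [map_add, map_smul, show W ν = Q + ι k by rw [hQ, sub_add_cancel]]
        module
      have h5 := hW (ν + s • Q) (-s)
      rw [neg_sq] at h5
      have h6 := norm_add_le (ν + s • Q + (-s) • W (ν + s • Q)) (s ^ 2 • W Q)
      rw [← h4, norm_smul, Real.norm_of_nonneg (sq_nonneg s)] at h6
      linarith
    have h3 : (1 + c * s ^ 2) * ‖ν + s • Q‖
        ≤ (1 + c * s ^ 2) * ((1 + c * s ^ 2) * ‖ν‖ - s * ‖k‖) := by
      gcongr
      linarith
    have h4 : (1 + c * s ^ 2) * ((1 + c * s ^ 2) * ‖ν‖ - s * ‖k‖)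
        ≤ ‖ν‖ + s ^ 2 * ((2 * c + c ^ 2) * ‖ν‖) - s * ‖k‖ := by
      have h5 : 0 ≤ c * s ^ 2 * (s * ‖k‖) := by positivity
      have h6 : c ^ 2 * s ^ 2 * s ^ 2 * ‖ν‖ ≤ c ^ 2 * s ^ 2 * 1 * ‖ν‖ := by
        gcongr
        nlinarith
      nlinarith
    have h5 : s * (2 * ‖k‖) ≤ s * (s * ((2 * c + c ^ 2) * ‖ν‖ + ‖W Q‖)) := by nlinarith
    exact le_of_mul_le_mul_left h5 hs0
  have hlim : Tendsto (fun s : ℝ => s * ((2 * c + c ^ 2) * ‖ν‖ + ‖W Q‖)) (𝓝[>] 0) (𝓝 0) := by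
    have : Continuous fun s : ℝ => s * ((2 * c + c ^ 2) * ‖ν‖ + ‖W Q‖) := by fun_prop
    simpa using (this.tendsto 0).mono_left nhdsWithin_le_nhds
  have hev : ∀ᶠ s in 𝓝[>] (0 : ℝ), 2 * ‖k‖ ≤ s * ((2 * c + c ^ 2) * ‖ν‖ + ‖W Q‖) := by
    have h1 : ∀ᶠ s in 𝓝[>] (0 : ℝ), s < 1 :=
      nhdsWithin_le_nhds (eventually_lt_nhds one_pos)
    filter_upwards [h1, self_mem_nhdsWithin] with s hs hs0
    exact key s hs0 hs.le
  have h1 := ge_of_tendsto hlim hev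
  exact norm_le_zero_iff.mp (by linarith)

end Accretive

/-! ### States and the numerical radius -/

section States

variable {𝕜 : Type*} [RCLike 𝕜] {X : Type*} [NormedAddCommGroup X] [NormedSpace 𝕜 X]

theorem exists_mem_numericalStates (𝕜 : Type*) [RCLike 𝕜] {X : Type*} [NormedAddCommGroup X]
    [NormedSpace 𝕜 X] {x : X} (hx : ‖x‖ = 1) : ∃ g, (g, x) ∈ numericalStates 𝕜 X := by
  obtain ⟨g, hg, hgx⟩ := exists_dual_vector 𝕜 x (by rw [hx]; exact one_ne_zero)
  exact ⟨g, hg, hx, by rw [hgx, hx, RCLike.ofReal_one]⟩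

theorem numericalStates_nonempty (𝕜 : Type*) [RCLike 𝕜] (X : Type*) [NormedAddCommGroup X]
    [NormedSpace 𝕜 X] [Nontrivial X] : (numericalStates 𝕜 X).Nonempty := by
  let : NormedSpace ℝ X := NormedSpace.restrictScalars ℝ 𝕜 X
  obtain ⟨x, hx⟩ := exists_norm_eq X zero_le_one
  obtain ⟨g, hg⟩ := exists_mem_numericalStates 𝕜 hx
  exact ⟨_, hg⟩

theorem mul_norm_le_norm_sub_smul (S : X →L[𝕜] X) {t : ℝ} (ht : 0 ≤ t) (x : X) :
    (1 - t * numericalRadius S) * ‖x‖ ≤ ‖x - (t : 𝕜) • S x‖ := by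
  rcases eq_or_ne x 0 with rfl | hx
  · simp
  have hx0 : ‖x‖ ≠ 0 := norm_ne_zero_iff.mpr hx
  set u : X := ((‖x‖⁻¹ : ℝ) : 𝕜) • x with hu
  have hxu : x = (‖x‖ : 𝕜) • u := by
    rw [hu, smul_smul, ← RCLike.ofReal_mul, mul_inv_cancel₀ hx0, RCLike.ofReal_one, one_smul]
  have hu1 : ‖u‖ = 1 := by
    rw [hu, norm_smul, RCLike.norm_ofReal, abs_of_nonneg (by positivity), inv_mul_cancel₀ hx0]
  obtain ⟨g, hg⟩ := exists_mem_numericalStates 𝕜 hu1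
  have h1 : g (x - (t : 𝕜) • S x) = (‖x‖ : 𝕜) * (1 - (t : 𝕜) * g (S u)) := by
    have h2 : g x = (‖x‖ : 𝕜) * 1 := by
      conv_lhs => rw [hxu]
      rw [map_smul, hg.2.2, smul_eq_mul]
    have h3 : g (S x) = (‖x‖ : 𝕜) * g (S u) := by
      conv_lhs => rw [hxu]
      rw [map_smul, map_smul, smul_eq_mul]
    rw [map_sub, map_smul, h2, h3, smul_eq_mul]
    ring
  have h2 : ‖g (x - (t : 𝕜) • S x)‖ ≤ ‖x - (t : 𝕜) • S x‖ := by
    simpa [hg.1] using g.le_opNorm (x - (t : 𝕜) • S x)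
  refine le_trans ?_ h2
  rw [h1, norm_mul, RCLike.norm_ofReal, abs_norm, mul_comm]
  gcongr
  have h3 : ‖(t : 𝕜) * g (S u)‖ ≤ t * numericalRadius S := by
    rw [norm_mul, RCLike.norm_ofReal, abs_of_nonneg ht]
    exact mul_le_mul_of_nonneg_left (norm_apply_le_numericalRadius S hg) ht
  have h4 := norm_sub_norm_le (1 : 𝕜) ((t : 𝕜) * g (S u))
  rw [norm_one] at h4
  linarith

/-- Lumer's theorem: a state of the Banach algebra `L(X)` is bounded by the numerical radius. -/
theorem norm_apply_le_numericalRadius_of_state (f : (X →L[𝕜] X) →ₗ[𝕜] 𝕜) (hf1 : f 1 = 1)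
    (hf : ∀ S, ‖f S‖ ≤ ‖S‖) (S : X →L[𝕜] X) : ‖f S‖ ≤ numericalRadius S := by
  obtain ⟨c, hc, hcS⟩ := RCLike.exists_norm_eq_mul_self (f S)
  set A := c • S with hA
  set r := ‖f S‖ with hr
  set v := numericalRadius S with hv
  have hv0 : 0 ≤ v := numericalRadius_nonneg S
  have hvA : numericalRadius A ≤ v := by
    simpa [hc] using numericalRadius_smul_le c S
  have hfA : f A = (r : 𝕜) := by rw [hA, map_smul, smul_eq_mul, hcS]
  -- `‖1 + tA‖ ≤ 1 + t v + O(t²)`, since `(1 - tA) (1 + tA) = 1 - t² A²`.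
  have key : ∀ t : ℝ, 0 < t → t * v < 1 → r - v ≤ t * (‖A‖ ^ 2 + r * v) := by
    intro t ht htv
    have htv' : 0 < 1 - t * v := by linarith
    have h1 : ‖1 + (t : 𝕜) • A‖ ≤ (1 + t ^ 2 * ‖A‖ ^ 2) / (1 - t * v) := by
      refine ContinuousLinearMap.opNorm_le_bound _ (by positivity) fun x => ?_
      rw [div_mul_eq_mul_div, le_div_iff₀ htv']
      have h2 := mul_norm_le_norm_sub_smul A ht.le (x + (t : 𝕜) • A x)
      have h3 : x + (t : 𝕜) • A x - (t : 𝕜) • A (x + (t : 𝕜) • A x)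
          = x - ((t : 𝕜) * (t : 𝕜)) • A (A x) := by
        simp only [map_add, map_smul]
        module
      have h4 : ‖x - ((t : 𝕜) * (t : 𝕜)) • A (A x)‖ ≤ ‖x‖ + (t * t) * (‖A‖ * (‖A‖ * ‖x‖)) := by
        refine (norm_sub_le _ _).trans ?_
        rw [norm_smul, norm_mul, RCLike.norm_ofReal, abs_of_pos ht]
        gcongr
        exact A.le_opNorm_of_le (A.le_opNorm x)
      rw [h3] at h2
      have h5 : (1 - t * v) * ‖x + (t : 𝕜) • A x‖
          ≤ (1 - t * numericalRadius A) * ‖x + (t : 𝕜) • A x‖ := by gcongr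
      change ‖x + (t : 𝕜) • A x‖ * (1 - t * v) ≤ _
      linarith
    have h2 : ‖f (1 + (t : 𝕜) • A)‖ = 1 + t * r := by
      rw [map_add, map_smul, hf1, hfA, smul_eq_mul, ← RCLike.ofReal_one, ← RCLike.ofReal_mul,
        ← RCLike.ofReal_add, RCLike.norm_ofReal, abs_of_nonneg]
      have := norm_nonneg (f S)
      positivity
    have h3 := (hf _).trans h1
    rw [h2, le_div_iff₀ htv'] at h3
    have h4 : t * (r - v) ≤ t * (t * (‖A‖ ^ 2 + r * v)) := by linarith
    exact le_of_mul_le_mul_left h4 ht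
  have hlim : Tendsto (fun t : ℝ => t * (‖A‖ ^ 2 + r * v)) (𝓝[>] 0) (𝓝 0) := by
    have : Continuous fun t : ℝ => t * (‖A‖ ^ 2 + r * v) := by fun_prop
    simpa using (this.tendsto 0).mono_left nhdsWithin_le_nhds
  have hev : ∀ᶠ t in 𝓝[>] (0 : ℝ), r - v ≤ t * (‖A‖ ^ 2 + r * v) := by
    have h2 : ∀ᶠ t in 𝓝[>] (0 : ℝ), t * v < 1 := by
      have : Tendsto (fun t : ℝ => t * v) (𝓝 0) (𝓝 (0 * v)) :=
        (continuous_mul_const _).tendsto 0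
      rw [zero_mul] at this
      exact nhdsWithin_le_nhds (this.eventually_lt_const one_pos)
    filter_upwards [h2, self_mem_nhdsWithin] with t ht ht0
    exact key t ht0 ht
  linarith [ge_of_tendsto hlim hev]

theorem norm_banachAdjoint_le (T : X →L[𝕜] X) : ‖banachAdjoint T‖ ≤ ‖T‖ :=
  ContinuousLinearMap.opNorm_le_bound _ (norm_nonneg _) fun g => by
    rw [mul_comm]
    exact g.opNorm_comp_le T

/-- A state on `X*` is a state of `L(X)`, hence bounded by the numerical radius. -/
theorem norm_apply_banachAdjoint_le {q : StrongDual 𝕜 (StrongDual 𝕜 X) × StrongDual 𝕜 X}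
    (hq : q ∈ numericalStates 𝕜 (StrongDual 𝕜 X)) (T : X →L[𝕜] X) :
    ‖q.1 (banachAdjoint T q.2)‖ ≤ numericalRadius T :=
  norm_apply_le_numericalRadius_of_state
    { toFun := fun S => q.1 (banachAdjoint S q.2)
      map_add' := fun S S' => by
        rw [← map_add]; congr 1; ext x; exact map_add q.2 (S x) (S' x)
      map_smul' := fun c S => by
        rw [RingHom.id_apply, ← map_smul]; congr 1; ext x; exact map_smul q.2 c (S x) }
    hq.2.2
    (fun S => (norm_apply_le_opNorm (banachAdjoint S) hq).trans (norm_banachAdjoint_le S)) T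

theorem inclusionInDoubleDual_mem_numericalStates {p : StrongDual 𝕜 X × X}
    (hp : p ∈ numericalStates 𝕜 X) :
    (NormedSpace.inclusionInDoubleDual 𝕜 X p.2, p.1) ∈ numericalStates 𝕜 (StrongDual 𝕜 X) :=
  ⟨((NormedSpace.inclusionInDoubleDualLi 𝕜).norm_map p.2).trans hp.2.1, hp.1, hp.2.2⟩

theorem numericalRadius_banachAdjoint (T : X →L[𝕜] X) :
    numericalRadius (banachAdjoint T) = numericalRadius T :=
  le_antisymm
    (numericalRadius_le _ (numericalRadius_nonneg T) fun _ hq => norm_apply_banachAdjoint_le hq T)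
    (numericalRadius_le _ (numericalRadius_nonneg _) fun _ hp =>
      norm_apply_le_numericalRadius (banachAdjoint T)
        (inclusionInDoubleDual_mem_numericalStates hp))

end States

/-! ### Rank-one operators and the farthest distance -/

namespace NumRadOp

variable {𝕜 : Type*} [RCLike 𝕜] {X : Type*} [NormedAddCommGroup X] [NormedSpace 𝕜 X]

/-- The rank-one operator `z ↦ g(z) x`, as an element of `L_v(X)`. -/
def rankOne (g : StrongDual 𝕜 X) (x : X) : NumRadOp 𝕜 X :=
  (toOp 𝕜 X).symm (g.smulRight x)

theorem toOp_rankOne_apply (g : StrongDual 𝕜 X) (x z : X) :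
    toOp 𝕜 X (rankOne g x) z = g z • x := rfl

theorem rankOne_mem_compactOps (g : StrongDual 𝕜 X) (x : X) : rankOne g x ∈ compactOps 𝕜 X := by
  have h : IsCompactOperator (ContinuousLinearMap.toSpanSingleton 𝕜 x) :=
    isCompactOperator_of_locallyCompactSpace_rng _
  exact mem_compactOps.mpr (h.comp_clm g)

theorem norm_rankOne_le (g : StrongDual 𝕜 X) (x : X) : ‖rankOne g x‖ ≤ ‖g‖ * ‖x‖ :=
  (norm_le_opNorm _).trans (ContinuousLinearMap.norm_smulRight_apply g x).le

/-- The unimodular multiple of the rank-one operator `x* ⊗ x` whose value at the state `(x*, x)`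
points away from that of `T`. -/
theorem exists_mem_compactOpsUnitBall_norm_sub_ge (T : NumRadOp 𝕜 X) {p : StrongDual 𝕜 X × X}
    (hp : p ∈ numericalStates 𝕜 X) :
    ∃ K ∈ compactOpsUnitBall 𝕜 X, ‖p.1 (toOp 𝕜 X T p.2)‖ + 1 ≤ ‖T - K‖ := by
  obtain ⟨c, hc, hcT⟩ := RCLike.exists_norm_eq_mul_self (p.1 (toOp 𝕜 X T p.2))
  have hc0 : c ≠ 0 := norm_ne_zero_iff.mp (by rw [hc]; exact one_ne_zero)
  refine ⟨-(c⁻¹ • rankOne p.1 p.2), ⟨?_, ?_⟩, ?_⟩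
  · exact Submodule.neg_mem _ (Submodule.smul_mem _ _ (rankOne_mem_compactOps _ _))
  · rw [norm_neg, norm_smul, norm_inv, hc, inv_one, one_mul]
    simpa [hp.1, hp.2.1] using norm_rankOne_le p.1 p.2
  · rw [sub_neg_eq_add, norm_def]
    refine le_trans (le_of_eq ?_) (norm_apply_le_numericalRadius _ hp)
    have h1 : p.1 (toOp 𝕜 X (T + c⁻¹ • rankOne p.1 p.2) p.2)
        = p.1 (toOp 𝕜 X T p.2) + c⁻¹ := by
      have h2 : toOp 𝕜 X (T + c⁻¹ • rankOne p.1 p.2) p.2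
          = toOp 𝕜 X T p.2 + c⁻¹ • (p.1 p.2 • p.2) := rfl
      rw [h2, map_add, map_smul, map_smul, hp.2.2]
      simp
    have h3 : c * (p.1 (toOp 𝕜 X T p.2) + c⁻¹)
        = ((‖p.1 (toOp 𝕜 X T p.2)‖ + 1 : ℝ) : 𝕜) := by
      rw [mul_add, ← hcT, mul_inv_cancel₀ hc0]
      push_cast
      rfl
    have h4 := congrArg norm h3
    rw [norm_mul, hc, one_mul, RCLike.norm_ofReal, abs_of_nonneg (by positivity)] at h4
    rw [h1, h4]

theorem norm_sub_le_of_mem_compactOpsUnitBall (T : NumRadOp 𝕜 X) {K : NumRadOp 𝕜 X}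
    (hK : K ∈ compactOpsUnitBall 𝕜 X) : ‖T - K‖ ≤ ‖T‖ + 1 :=
  (norm_sub_le T K).trans (by gcongr; exact hK.2)

theorem norm_sub_le_farthestDist (T : NumRadOp 𝕜 X) {K : NumRadOp 𝕜 X}
    (hK : K ∈ compactOpsUnitBall 𝕜 X) :
    ‖T - K‖ ≤ farthestDist T (compactOpsUnitBall 𝕜 X) := by
  refine le_csSup ⟨‖T‖ + 1, ?_⟩ ⟨K, hK, rfl⟩
  rintro _ ⟨K', hK', rfl⟩
  exact norm_sub_le_of_mem_compactOpsUnitBall T hK'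

theorem farthestDist_compactOpsUnitBall [Nontrivial X] (T : NumRadOp 𝕜 X) :
    farthestDist T (compactOpsUnitBall 𝕜 X) = numericalRadius (toOp 𝕜 X T) + 1 := by
  have hge : ∀ p ∈ numericalStates 𝕜 X,
      ‖p.1 (toOp 𝕜 X T p.2)‖ + 1 ≤ farthestDist T (compactOpsUnitBall 𝕜 X) := by
    intro p hp
    obtain ⟨K, hK, h⟩ := exists_mem_compactOpsUnitBall_norm_sub_ge T hp
    exact h.trans (norm_sub_le_farthestDist T hK)
  refine le_antisymm ?_ ?_
  · have h0 : (0 : NumRadOp 𝕜 X) ∈ compactOpsUnitBall 𝕜 X :=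
      ⟨Submodule.zero_mem _, by rw [norm_zero]; exact zero_le_one⟩
    refine csSup_le ⟨‖T - 0‖, 0, h0, rfl⟩ ?_
    rintro _ ⟨K, hK, rfl⟩
    exact norm_sub_le_of_mem_compactOpsUnitBall T hK
  · obtain ⟨p, hp⟩ := numericalStates_nonempty 𝕜 X
    have h := numericalRadius_le (toOp 𝕜 X T)
      (c := farthestDist T (compactOpsUnitBall 𝕜 X) - 1)
      (by linarith [hge p hp, norm_nonneg (p.1 (toOp 𝕜 X T p.2))])
      (fun p hp => by linarith [hge p hp])
    linarith

theorem hasFarthestPoint_of_attainsNumericalRadius [Nontrivial X] {T : NumRadOp 𝕜 X}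
    (hT : AttainsNumericalRadius (toOp 𝕜 X T)) : HasFarthestPoint T (compactOpsUnitBall 𝕜 X) := by
  obtain ⟨p, hp, hpT⟩ := hT
  obtain ⟨K, hK, h⟩ := exists_mem_compactOpsUnitBall_norm_sub_ge T hp
  refine ⟨K, hK, le_antisymm (norm_sub_le_farthestDist T hK) ?_⟩
  rwa [farthestDist_compactOpsUnitBall, ← hpT]

end NumRadOp

/-! ### Biduals -/

section Bidual

variable {𝕜 : Type*} [RCLike 𝕜] {X : Type*} [NormedAddCommGroup X] [NormedSpace 𝕜 X]

/-- The restriction `X*** → X*` of a functional on `X**` to the canonical image of `X`. -/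
def restrictToPredual (𝕜 : Type*) [RCLike 𝕜] (X : Type*) [NormedAddCommGroup X]
    [NormedSpace 𝕜 X] :
    StrongDual 𝕜 (StrongDual 𝕜 (StrongDual 𝕜 X)) →L[𝕜] StrongDual 𝕜 X :=
  ContinuousLinearMap.precomp 𝕜 (NormedSpace.inclusionInDoubleDual 𝕜 X)

theorem restrictToPredual_apply (y : StrongDual 𝕜 (StrongDual 𝕜 (StrongDual 𝕜 X))) (x : X) :
    restrictToPredual 𝕜 X y x = y (NormedSpace.inclusionInDoubleDual 𝕜 X x) := rfl

theorem restrictToPredual_inclusion (g : StrongDual 𝕜 X) :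
    restrictToPredual 𝕜 X (NormedSpace.inclusionInDoubleDual 𝕜 (StrongDual 𝕜 X) g) = g := rfl

theorem norm_inclusionInDoubleDual (x : X) :
    ‖NormedSpace.inclusionInDoubleDual 𝕜 X x‖ = ‖x‖ :=
  (NormedSpace.inclusionInDoubleDualLi 𝕜).norm_map x

/-- For a compact `K`, the operator `K**` maps `X**` into the norm closure of `X`: functionals on
`X**` that vanish on `X` vanish on its range. -/
theorem apply_banachAdjoint_banachAdjoint_eq_zero {K : X →L[𝕜] X} (hK : IsCompactOperator K)
    {ν : StrongDual 𝕜 (StrongDual 𝕜 (StrongDual 𝕜 X))} (hν : restrictToPredual 𝕜 X ν = 0)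
    (F : StrongDual 𝕜 (StrongDual 𝕜 X)) : ν (banachAdjoint (banachAdjoint K) F) = 0 := by
  have hν' : ∀ x, ν (NormedSpace.inclusionInDoubleDual 𝕜 X x) = 0 := fun x => by
    rw [← restrictToPredual_apply, hν]; rfl
  set ξ := banachAdjoint (banachAdjoint K) F with hξ
  have hξg : ∀ g, ξ g = F (banachAdjoint K g) := fun g => rfl
  obtain ⟨V, hV, hKV⟩ := hK.image_closedBall_subset_compact (f := K.toLinearMap) 1
  have key : ∀ ε : ℝ, 0 < ε → ‖ν ξ‖ ≤ ε * (‖ν‖ * ‖F‖) := by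
    intro ε hε
    obtain ⟨t, -, htfin, hcover⟩ := finite_cover_balls_of_compact hV hε
    have := htfin.to_subtype
    -- On the functionals vanishing on the finite `ε`-net `t` of `K(B)`, the norm of `ξ` is at most
    -- `ε ‖F‖`. A small extension of this restriction differs from `ξ` by an element of `span t`.
    let ev : t → (StrongDual 𝕜 X →ₗ[𝕜] 𝕜) := fun x =>
      (NormedSpace.inclusionInDoubleDual 𝕜 X (x : X)).toLinearMap
    let N : Submodule 𝕜 (StrongDual 𝕜 X) := ⨅ x, LinearMap.ker (ev x)
    have hN : ∀ g ∈ N, ∀ x ∈ t, g x = 0 := fun g hg x hx =>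
      LinearMap.mem_ker.mp ((Submodule.mem_iInf _).mp hg ⟨x, hx⟩)
    have hadj : ∀ g ∈ N, ‖banachAdjoint K g‖ ≤ ε * ‖g‖ := by
      intro g hg
      refine ContinuousLinearMap.opNorm_le_of_unit_norm (by positivity) fun x hx => ?_
      obtain ⟨z, hz, hxz⟩ := mem_iUnion₂.mp (hcover (hKV ⟨x, by simp [hx], rfl⟩))
      rw [mem_ball, dist_eq_norm] at hxz
      rw [banachAdjoint_apply, ← sub_zero (g (K x)), ← hN g hg z hz, ← map_sub, mul_comm]
      exact g.le_opNorm_of_le hxz.le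
    let ξN : StrongDual 𝕜 N := ξ.comp N.subtypeL
    have hξN : ‖ξN‖ ≤ ε * ‖F‖ := by
      refine ContinuousLinearMap.opNorm_le_bound _ (by positivity) fun g => ?_
      calc ‖ξ g‖ ≤ ‖F‖ * (ε * ‖g‖) := F.le_opNorm_of_le (hadj g g.2)
        _ = ε * ‖F‖ * ‖g‖ := by ring
    obtain ⟨ξ', hξ', hξ'n⟩ := exists_extension_norm_eq N ξN
    have hspan : (ξ - ξ').toLinearMap ∈ Submodule.span 𝕜 (range ev) := by
      refine mem_span_of_iInf_ker_le_ker fun g hg => ?_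
      rw [LinearMap.mem_ker]
      have h1 : ξ' g = ξ g := hξ' ⟨g, hg⟩
      change ξ g - ξ' g = 0
      rw [h1, sub_self]
    have hmem : ∃ x : X, ξ - ξ' = NormedSpace.inclusionInDoubleDual 𝕜 X x := by
      let _ := Fintype.ofFinite t
      obtain ⟨c, hc⟩ := (Submodule.mem_span_range_iff_exists_fun 𝕜).mp hspan
      refine ⟨∑ x : t, c x • (x : X), ?_⟩
      ext g
      have h1 := LinearMap.congr_fun hc g
      rw [LinearMap.sum_apply] at h1
      rw [map_sum]
      refine h1.symm.trans ?_
      rw [_root_.sum_apply]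
      refine Finset.sum_congr rfl fun x _ => ?_
      rw [map_smul]
      rfl
    obtain ⟨x, hx⟩ := hmem
    have h1 : ν ξ = ν ξ' := by
      rw [← sub_eq_zero, ← map_sub, hx, hν']
    rw [h1]
    calc ‖ν ξ'‖ ≤ ‖ν‖ * (ε * ‖F‖) := ν.le_opNorm_of_le (hξ'n.trans_le hξN)
      _ = ε * (‖ν‖ * ‖F‖) := by ring
  have hlim : Tendsto (fun ε : ℝ => ε * (‖ν‖ * ‖F‖)) (𝓝[>] 0) (𝓝 0) := by
    have : Continuous fun ε : ℝ => ε * (‖ν‖ * ‖F‖) := by fun_prop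
    simpa using (this.tendsto 0).mono_left nhdsWithin_le_nhds
  have hev : ∀ᶠ ε in 𝓝[>] (0 : ℝ), ‖ν ξ‖ ≤ ε * (‖ν‖ * ‖F‖) := by
    filter_upwards [self_mem_nhdsWithin] with ε hε
    exact key ε hε
  exact norm_le_zero_iff.mp (ge_of_tendsto hlim hev)

theorem apply_banachAdjoint_banachAdjoint_of_isCompactOperator {K : X →L[𝕜] X}
    (hK : IsCompactOperator K) (y : StrongDual 𝕜 (StrongDual 𝕜 (StrongDual 𝕜 X)))
    (F : StrongDual 𝕜 (StrongDual 𝕜 X)) :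
    y (banachAdjoint (banachAdjoint K) F) = F (banachAdjoint K (restrictToPredual 𝕜 X y)) := by
  have h := apply_banachAdjoint_banachAdjoint_eq_zero hK
    (ν := y - NormedSpace.inclusionInDoubleDual 𝕜 (StrongDual 𝕜 X) (restrictToPredual 𝕜 X y))
    (by rw [map_sub, restrictToPredual_inclusion, sub_self]) F
  exact sub_eq_zero.mp h

/-- An element of `X**` annihilated by `X^⊥` lies in `X`, when `X` is complete. -/
theorem exists_inclusion_eq_of_forall_apply_eq_zero [CompleteSpace X]
    {ξ : StrongDual 𝕜 (StrongDual 𝕜 X)}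
    (h : ∀ ν, restrictToPredual 𝕜 X ν = 0 → ν ξ = 0) :
    ∃ x, NormedSpace.inclusionInDoubleDual 𝕜 X x = ξ := by
  let S : Submodule 𝕜 (StrongDual 𝕜 (StrongDual 𝕜 X)) :=
    LinearMap.range (NormedSpace.inclusionInDoubleDual 𝕜 X).toLinearMap
  have hS : IsClosed (S : Set (StrongDual 𝕜 (StrongDual 𝕜 X))) := by
    exact (NormedSpace.inclusionInDoubleDualLi 𝕜 (E := X)).isometry.isClosedEmbedding.isClosed_range
  by_contra hξ
  have hξS : S.mkQ ξ ≠ 0 := fun h0 => hξ ((Submodule.Quotient.mk_eq_zero S).mp h0)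
  obtain ⟨f, -, hf⟩ := exists_dual_vector 𝕜 (S.mkQ ξ) (norm_ne_zero_iff.mpr hξS)
  have h1 : f.comp S.mkQL ξ = 0 := by
    refine h _ ?_
    ext x
    have h2 : S.mkQ (NormedSpace.inclusionInDoubleDual 𝕜 X x) = 0 :=
      (Submodule.Quotient.mk_eq_zero S).mpr ⟨x, rfl⟩
    change f (S.mkQ (NormedSpace.inclusionInDoubleDual 𝕜 X x)) = 0
    rw [h2, map_zero]
  change f (S.mkQ ξ) = 0 at h1
  rw [hf, RCLike.ofReal_eq_zero, norm_eq_zero] at h1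
  exact hξS h1

end Bidual

/-! ### The part of a state carried by the compact operators -/

section LProjection

variable {𝕜 : Type*} [RCLike 𝕜] {E : Type*} [SeminormedAddCommGroup E] [NormedSpace 𝕜 E]

/-- The part `f - P f` of a functional complementary to `J^⊥` depends only on its restriction
to `J`. -/
theorem IsDualLProjection.sub_apply_eq_of_eqOn {P : StrongDual 𝕜 E →L[𝕜] StrongDual 𝕜 E}
    {J : Submodule 𝕜 E} (hP : IsDualLProjection P)
    (hJ : LinearMap.range P.toLinearMap = annihilatorInDual J) {f g : StrongDual 𝕜 E}
    (h : ∀ x ∈ J, f x = g x) : f - P f = g - P g := by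
  have h1 : f - g ∈ LinearMap.range P.toLinearMap := by
    rw [hJ]
    intro x hx
    change f x - g x = 0
    rw [h x hx, sub_self]
  obtain ⟨k, hk⟩ := h1
  have hk' : P k = f - g := hk
  have h2 : P (f - g) = f - g := by rw [← hk', hP.proj]
  rw [map_sub] at h2
  rw [sub_eq_sub_iff_sub_eq_sub, ← h2]

theorem apply_eq_zero_of_range_eq_annihilator {P : StrongDual 𝕜 E →L[𝕜] StrongDual 𝕜 E}
    {J : Submodule 𝕜 E}
    (hJ : LinearMap.range P.toLinearMap = annihilatorInDual J) (f : StrongDual 𝕜 E) {x : E}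
    (hx : x ∈ J) : P f x = 0 := by
  have h1 : P f ∈ annihilatorInDual J := hJ ▸ LinearMap.mem_range_self P.toLinearMap f
  exact h1 x hx

end LProjection

namespace NumRadOp

variable {𝕜 : Type*} [RCLike 𝕜] {X : Type*} [NormedAddCommGroup X] [NormedSpace 𝕜 X]

variable (𝕜 X) in
/-- The identity operator, as an element of `L_v(X)`. -/
def one : NumRadOp 𝕜 X := (toOp 𝕜 X).symm 1

theorem norm_one_le : ‖one 𝕜 X‖ ≤ 1 :=
  (norm_le_opNorm _).trans ContinuousLinearMap.norm_id_le

/-- The functional `S ↦ x**(S* x*)` on `L_v(X)`; it is bounded because `n(X) > 0`. -/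
def tensor (hn : 0 < numericalIndex 𝕜 X) (g : StrongDual 𝕜 X)
    (F : StrongDual 𝕜 (StrongDual 𝕜 X)) : StrongDual 𝕜 (NumRadOp 𝕜 X) :=
  LinearMap.mkContinuous
    { toFun := fun S => F (banachAdjoint (toOp 𝕜 X S) g)
      map_add' := fun S S' => by
        rw [← map_add]; congr 1; ext x
        exact map_add g (toOp 𝕜 X S x) (toOp 𝕜 X S' x)
      map_smul' := fun c S => by
        rw [RingHom.id_apply, ← map_smul]; congr 1; ext x
        exact map_smul g c (toOp 𝕜 X S x) }
    ((numericalIndex 𝕜 X)⁻¹ * ‖g‖ * ‖F‖) fun S => by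
      have h1 : ‖toOp 𝕜 X S‖ ≤ (numericalIndex 𝕜 X)⁻¹ * ‖S‖ := by
        rw [← div_eq_inv_mul, le_div_iff₀ hn, mul_comm]
        exact mul_opNorm_le_norm S
      calc ‖F (banachAdjoint (toOp 𝕜 X S) g)‖
          ≤ ‖F‖ * (((numericalIndex 𝕜 X)⁻¹ * ‖S‖) * ‖g‖) :=
            F.le_opNorm_of_le (ContinuousLinearMap.le_of_opNorm_le _
              ((norm_banachAdjoint_le _).trans h1) g)
        _ = (numericalIndex 𝕜 X)⁻¹ * ‖g‖ * ‖F‖ * ‖S‖ := by ring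

theorem tensor_apply (hn : 0 < numericalIndex 𝕜 X) (g : StrongDual 𝕜 X)
    (F : StrongDual 𝕜 (StrongDual 𝕜 X)) (S : NumRadOp 𝕜 X) :
    tensor hn g F S = F (banachAdjoint (toOp 𝕜 X S) g) := rfl

theorem norm_tensor_le (hn : 0 < numericalIndex 𝕜 X) (g : StrongDual 𝕜 X)
    (F : StrongDual 𝕜 (StrongDual 𝕜 X)) :
    ‖tensor hn g F‖ ≤ (numericalIndex 𝕜 X)⁻¹ * ‖g‖ * ‖F‖ :=
  LinearMap.mkContinuous_norm_le _ (by positivity) _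

/-- The map `M : X* → X***` with `(M x*)(x**) = (φ - P φ)(1)`, where `φ(S) = x**(S* x*)`. When `P`
is the L-projection onto the annihilator of the compact operators, this is the value at the
identity of the part of `φ` carried by the compact operators. -/
def compactPartAtOne (hn : 0 < numericalIndex 𝕜 X)
    (P : StrongDual 𝕜 (NumRadOp 𝕜 X) →L[𝕜] StrongDual 𝕜 (NumRadOp 𝕜 X)) :
    StrongDual 𝕜 X →L[𝕜] StrongDual 𝕜 (StrongDual 𝕜 (StrongDual 𝕜 X)) :=
  LinearMap.mkContinuous₂
    (LinearMap.mk₂ 𝕜 (fun g F => (tensor hn g F - P (tensor hn g F)) (one 𝕜 X))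
      (fun g g' F => by
        have h : tensor hn (g + g') F = tensor hn g F + tensor hn g' F := by
          ext S
          exact map_add F (banachAdjoint (toOp 𝕜 X S) g) (banachAdjoint (toOp 𝕜 X S) g')
        rw [h, map_add, add_sub_add_comm]; rfl)
      (fun c g F => by
        have h : tensor hn (c • g) F = c • tensor hn g F := by
          ext S
          exact map_smul F c (banachAdjoint (toOp 𝕜 X S) g)
        rw [h, map_smul, ← smul_sub]; rfl)
      (fun g F F' => by
        have h : tensor hn g (F + F') = tensor hn g F + tensor hn g F' := rfl
        rw [h, map_add, add_sub_add_comm]; rfl)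
      (fun c g F => by
        have h : tensor hn g (c • F) = c • tensor hn g F := rfl
        rw [h, map_smul, ← smul_sub]; rfl))
    ((1 + ‖P‖) * (numericalIndex 𝕜 X)⁻¹) fun g F => by
      rw [LinearMap.mk₂_apply]
      have h1 : ‖tensor hn g F - P (tensor hn g F)‖ ≤ (1 + ‖P‖) * ‖tensor hn g F‖ := by
        refine (norm_sub_le _ _).trans ?_
        rw [add_mul, one_mul]
        gcongr
        exact P.le_opNorm _
      calc ‖(tensor hn g F - P (tensor hn g F)) (one 𝕜 X)‖
          ≤ ((1 + ‖P‖) * ‖tensor hn g F‖) * 1 :=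
            ContinuousLinearMap.le_of_opNorm_le_of_le _ h1 norm_one_le
        _ ≤ ((1 + ‖P‖) * ((numericalIndex 𝕜 X)⁻¹ * ‖g‖ * ‖F‖)) * 1 := by
            gcongr
            exact norm_tensor_le hn g F
        _ = (1 + ‖P‖) * (numericalIndex 𝕜 X)⁻¹ * ‖g‖ * ‖F‖ := by ring

theorem compactPartAtOne_apply (hn : 0 < numericalIndex 𝕜 X)
    (P : StrongDual 𝕜 (NumRadOp 𝕜 X) →L[𝕜] StrongDual 𝕜 (NumRadOp 𝕜 X))
    (g : StrongDual 𝕜 X) (F : StrongDual 𝕜 (StrongDual 𝕜 X)) :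
    compactPartAtOne hn P g F = (tensor hn g F - P (tensor hn g F)) (one 𝕜 X) := rfl

section MIdeal

variable {hn : 0 < numericalIndex 𝕜 X}
  {P : StrongDual 𝕜 (NumRadOp 𝕜 X) →L[𝕜] StrongDual 𝕜 (NumRadOp 𝕜 X)}

theorem compactPartAtOne_eq_of_eqOn (hP : IsDualLProjection P)
    (hJ : LinearMap.range P.toLinearMap = annihilatorInDual (compactOps 𝕜 X))
    {φ : StrongDual 𝕜 (NumRadOp 𝕜 X)} {g : StrongDual 𝕜 X} {F : StrongDual 𝕜 (StrongDual 𝕜 X)}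
    (hφ : ∀ K ∈ compactOps 𝕜 X, φ K = F (banachAdjoint (toOp 𝕜 X K) g)) :
    compactPartAtOne hn P g F = (φ - P φ) (one 𝕜 X) := by
  rw [compactPartAtOne_apply, hP.sub_apply_eq_of_eqOn hJ (f := φ) (g := tensor hn g F) hφ]

theorem norm_compactPartAtOne_le (hP : IsDualLProjection P)
    (hJ : LinearMap.range P.toLinearMap = annihilatorInDual (compactOps 𝕜 X))
    {φ : StrongDual 𝕜 (NumRadOp 𝕜 X)} (hφ1 : ‖φ‖ ≤ 1) {g : StrongDual 𝕜 X}
    {F : StrongDual 𝕜 (StrongDual 𝕜 X)}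
    (hφ : ∀ K ∈ compactOps 𝕜 X, φ K = F (banachAdjoint (toOp 𝕜 X K) g)) :
    ‖compactPartAtOne hn P g F‖ ≤ 1 := by
  have h1 : ‖φ - P φ‖ ≤ 1 := by linarith [hP.norm_eq φ, norm_nonneg (P φ)]
  rw [compactPartAtOne_eq_of_eqOn hP hJ hφ]
  simpa using ContinuousLinearMap.le_of_opNorm_le_of_le _ h1 norm_one_le

/-- For a state `φ` of `L_v(X)` given on the compact operators by `K ↦ x**(K* x*)`, the norm of the
part `φ - P φ` carried by the compact operators is its value at the identity. Rank-one operators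
bound it from below by `‖x*‖ ‖x**‖`. -/
theorem norm_mul_norm_le_re_compactPartAtOne (hP : IsDualLProjection P)
    (hJ : LinearMap.range P.toLinearMap = annihilatorInDual (compactOps 𝕜 X))
    {φ : StrongDual 𝕜 (NumRadOp 𝕜 X)} (hφ1 : ‖φ‖ ≤ 1) (hφ2 : φ (one 𝕜 X) = 1)
    {g : StrongDual 𝕜 X} {F : StrongDual 𝕜 (StrongDual 𝕜 X)}
    (hφ : ∀ K ∈ compactOps 𝕜 X, φ K = F (banachAdjoint (toOp 𝕜 X K) g)) :
    ‖g‖ * ‖F‖ ≤ RCLike.re (compactPartAtOne hn P g F) := by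
  have h1 : ‖φ - P φ‖ ≤ RCLike.re (compactPartAtOne hn P g F) := by
    rw [compactPartAtOne_eq_of_eqOn hP hJ hφ]
    have h2 : RCLike.re ((φ - P φ) (one 𝕜 X)) = 1 - RCLike.re (P φ (one 𝕜 X)) := by
      change RCLike.re (φ (one 𝕜 X) - P φ (one 𝕜 X)) = _
      rw [hφ2, map_sub, RCLike.one_re]
    have h3 : RCLike.re (P φ (one 𝕜 X)) ≤ ‖P φ‖ :=
      (RCLike.re_le_norm _).trans (by
        simpa using ContinuousLinearMap.le_of_opNorm_le_of_le (P φ) le_rfl norm_one_le)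
    linarith [hP.norm_eq φ]
  refine le_trans ?_ h1
  have h2 : ∀ (z : StrongDual 𝕜 X) (x : X), ‖g x‖ * ‖F z‖ ≤ ‖φ - P φ‖ * (‖z‖ * ‖x‖) := by
    intro z x
    have h3 : (φ - P φ) (rankOne z x) = g x * F z := by
      change φ (rankOne z x) - P φ (rankOne z x) = _
      rw [apply_eq_zero_of_range_eq_annihilator hJ φ (rankOne_mem_compactOps z x), sub_zero,
        hφ _ (rankOne_mem_compactOps z x), ← smul_eq_mul, ← map_smul]
      congr 1
      ext w
      rw [banachAdjoint_apply, toOp_rankOne_apply, map_smul, smul_eq_mul, mul_comm]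
      rfl
    rw [← norm_mul, ← h3]
    exact (φ - P φ).le_opNorm_of_le (norm_rankOne_le z x)
  have h3 : ∀ z : StrongDual 𝕜 X, ‖F z‖ * ‖g‖ ≤ ‖φ - P φ‖ * ‖z‖ := by
    intro z
    have : ‖F z • g‖ ≤ ‖φ - P φ‖ * ‖z‖ :=
      ContinuousLinearMap.opNorm_le_bound _ (by positivity) fun x => by
        have := h2 z x
        change ‖F z • g x‖ ≤ _
        rw [norm_smul]
        linarith
    rwa [norm_smul] at this
  have h4 : ‖(‖g‖ : 𝕜) • F‖ ≤ ‖φ - P φ‖ :=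
    ContinuousLinearMap.opNorm_le_bound _ (norm_nonneg _) fun z => by
      have := h3 z
      change ‖(‖g‖ : 𝕜) • F z‖ ≤ _
      rw [norm_smul, RCLike.norm_ofReal, abs_norm]
      linarith
  rwa [norm_smul, RCLike.norm_ofReal, abs_norm] at h4

/-- A state of `X` acts as a state of `L_v(X)`. -/
theorem exists_functional_of_numericalStates {p : StrongDual 𝕜 X × X}
    (hp : p ∈ numericalStates 𝕜 X) :
    ∃ φ : StrongDual 𝕜 (NumRadOp 𝕜 X), ‖φ‖ ≤ 1 ∧ ∀ S, φ S = p.1 (toOp 𝕜 X S p.2) := by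
  refine ⟨LinearMap.mkContinuous
    { toFun := fun S => p.1 (toOp 𝕜 X S p.2)
      map_add' := fun S S' => map_add p.1 (toOp 𝕜 X S p.2) (toOp 𝕜 X S' p.2)
      map_smul' := fun c S => map_smul p.1 c (toOp 𝕜 X S p.2) } 1 fun S => ?_,
    LinearMap.mkContinuous_norm_le _ zero_le_one _, fun S => rfl⟩
  rw [one_mul]
  exact norm_apply_le_numericalRadius _ hp

/-- A state of `X**` acts as a state of `L_v(X)`. -/
theorem exists_functional_of_numericalStates_bidual
    {q : StrongDual 𝕜 (StrongDual 𝕜 (StrongDual 𝕜 X)) × StrongDual 𝕜 (StrongDual 𝕜 X)}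
    (hq : q ∈ numericalStates 𝕜 (StrongDual 𝕜 (StrongDual 𝕜 X))) :
    ∃ φ : StrongDual 𝕜 (NumRadOp 𝕜 X), ‖φ‖ ≤ 1 ∧
      ∀ S, φ S = q.1 (banachAdjoint (banachAdjoint (toOp 𝕜 X S)) q.2) := by
  refine ⟨LinearMap.mkContinuous
    { toFun := fun S => q.1 (banachAdjoint (banachAdjoint (toOp 𝕜 X S)) q.2)
      map_add' := fun S S' => ?_
      map_smul' := fun c S => ?_ } 1 fun S => ?_,
    LinearMap.mkContinuous_norm_le _ zero_le_one _, fun S => rfl⟩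
  · rw [← map_add]; congr 1; ext g
    change q.2 _ = q.2 _ + q.2 _
    rw [← map_add]; congr 1; ext x
    exact map_add g (toOp 𝕜 X S x) (toOp 𝕜 X S' x)
  · rw [RingHom.id_apply, ← map_smul]; congr 1; ext g
    change q.2 _ = c • q.2 _
    rw [← map_smul]; congr 1; ext x
    exact map_smul g c (toOp 𝕜 X S x)
  · rw [one_mul]
    refine (norm_apply_le_numericalRadius (banachAdjoint (banachAdjoint (toOp 𝕜 X S))) hq).trans ?_
    rw [numericalRadius_banachAdjoint, numericalRadius_banachAdjoint]
    rfl

theorem compactPartAtOne_apply_of_numericalStates (hP : IsDualLProjection P)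
    (hJ : LinearMap.range P.toLinearMap = annihilatorInDual (compactOps 𝕜 X))
    {p : StrongDual 𝕜 X × X} (hp : p ∈ numericalStates 𝕜 X) :
    compactPartAtOne hn P p.1 (NormedSpace.inclusionInDoubleDual 𝕜 X p.2) = 1 := by
  obtain ⟨φ, hφ1, hφ⟩ := exists_functional_of_numericalStates hp
  have hφ2 : φ (one 𝕜 X) = 1 := (hφ _).trans hp.2.2
  have hφJ : ∀ K ∈ compactOps 𝕜 X, φ K = NormedSpace.inclusionInDoubleDual 𝕜 X p.2
      (banachAdjoint (toOp 𝕜 X K) p.1) := fun K _ => hφ K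
  have h1 := norm_mul_norm_le_re_compactPartAtOne (hn := hn) hP hJ hφ1 hφ2 hφJ
  have h2 := norm_compactPartAtOne_le (hn := hn) hP hJ hφ1 hφJ
  rw [norm_inclusionInDoubleDual, hp.1, hp.2.1, one_mul] at h1
  set a := compactPartAtOne hn P p.1 (NormedSpace.inclusionInDoubleDual 𝕜 X p.2)
  have h3 : RCLike.re a = 1 := le_antisymm ((RCLike.re_le_norm a).trans h2) h1
  rw [← RCLike.re_eq_self_of_le (h2.trans h1), h3, RCLike.ofReal_one]

theorem norm_restrictToPredual_le_re_compactPartAtOne (hP : IsDualLProjection P)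
    (hJ : LinearMap.range P.toLinearMap = annihilatorInDual (compactOps 𝕜 X))
    {q : StrongDual 𝕜 (StrongDual 𝕜 (StrongDual 𝕜 X)) × StrongDual 𝕜 (StrongDual 𝕜 X)}
    (hq : q ∈ numericalStates 𝕜 (StrongDual 𝕜 (StrongDual 𝕜 X))) :
    ‖restrictToPredual 𝕜 X q.1‖
      ≤ RCLike.re (compactPartAtOne hn P (restrictToPredual 𝕜 X q.1) q.2) := by
  obtain ⟨φ, hφ1, hφ⟩ := exists_functional_of_numericalStates_bidual hq
  have h1 := norm_mul_norm_le_re_compactPartAtOne (hn := hn) hP hJ hφ1 ((hφ _).trans hq.2.2)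
    (g := restrictToPredual 𝕜 X q.1) (F := q.2) fun K hK => by
      rw [hφ, apply_banachAdjoint_banachAdjoint_of_isCompactOperator (mem_compactOps.mp hK)]
  rwa [hq.2.1, mul_one] at h1

end MIdeal

end NumRadOp

/-! ### The compact operators carry all functionals `x** ⊗ x*` -/

/-- A closed property of functionals holds for all of them as soon as it holds for the nonnegative
multiples of the functionals `g` in states `(g, z)`. -/
theorem forall_of_isClosed_of_numericalStates {𝕜 : Type*} [RCLike 𝕜] {Y : Type*}
    [NormedAddCommGroup Y] [NormedSpace 𝕜 Y] [CompleteSpace Y] [Nontrivial Y]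
    {C : Set (StrongDual 𝕜 Y)} (hC : IsClosed C)
    (h : ∀ p ∈ numericalStates 𝕜 Y, ∀ r : ℝ, 0 ≤ r → r • p.1 ∈ C) (g : StrongDual 𝕜 Y) :
    g ∈ C := by
  rw [← hC.closure_eq, Metric.mem_closure_iff]
  intro ε hε
  obtain ⟨g', z, hz, hgg', hgz⟩ := exists_normAttaining_near g (half_pos hε)
  refine ⟨g', ?_, by rw [dist_comm, dist_eq_norm]; linarith⟩
  rcases eq_or_ne g' 0 with rfl | hg'
  · obtain ⟨p, hp⟩ := numericalStates_nonempty 𝕜 Y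
    simpa using h p hp 0 le_rfl
  have hn0 : ‖g'‖ ≠ 0 := norm_ne_zero_iff.mpr hg'
  have h1 := h (‖g'‖⁻¹ • g', z) ⟨?_, hz, ?_⟩ ‖g'‖ (norm_nonneg _)
  · rwa [smul_inv_smul₀ hn0] at h1
  · rw [norm_smul, norm_inv, norm_norm, inv_mul_cancel₀ hn0]
  · change ‖g'‖⁻¹ • g' z = 1
    rw [hgz, RCLike.real_smul_eq_coe_mul, ← RCLike.ofReal_mul, inv_mul_cancel₀ hn0,
      RCLike.ofReal_one]

section Adjoint

variable {𝕜 : Type*} [RCLike 𝕜] {X : Type*} [NormedAddCommGroup X] [NormedSpace 𝕜 X]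

/-- If `1 + s Z` is an isometry of `X*` to first order in `s`, then so is `1 + s Z**` on `X***`. -/
theorem norm_add_smul_banachAdjoint_banachAdjoint_le {Z : X →L[𝕜] X} {c : ℝ} (hc : 0 ≤ c)
    (hZ : ∀ (x : X) (s : ℝ), ‖x + (s : 𝕜) • Z x‖ ≤ (1 + c * s ^ 2) * ‖x‖)
    (F : StrongDual 𝕜 (StrongDual 𝕜 X)) (s : ℝ) :
    ‖F + s • banachAdjoint (banachAdjoint Z) F‖ ≤ (1 + c * s ^ 2) * ‖F‖ := by
  have h1 : ∀ g : StrongDual 𝕜 X,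
      ‖g + (s : 𝕜) • banachAdjoint Z g‖ ≤ (1 + c * s ^ 2) * ‖g‖ := by
    intro g
    refine ContinuousLinearMap.opNorm_le_bound _ (by positivity) fun x => ?_
    have h2 : (g + (s : 𝕜) • banachAdjoint Z g) x = g (x + (s : 𝕜) • Z x) := by
      rw [map_add, map_smul]; rfl
    rw [h2]
    calc ‖g (x + (s : 𝕜) • Z x)‖ ≤ ‖g‖ * ((1 + c * s ^ 2) * ‖x‖) := g.le_opNorm_of_le (hZ x s)
      _ = (1 + c * s ^ 2) * ‖g‖ * ‖x‖ := by ring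
  refine ContinuousLinearMap.opNorm_le_bound _ (by positivity) fun g => ?_
  have h2 : (F + s • banachAdjoint (banachAdjoint Z) F) g
      = F (g + (s : 𝕜) • banachAdjoint Z g) := by
    rw [map_add, map_smul, smul_eq_mul, ← RCLike.real_smul_eq_coe_mul]; rfl
  rw [h2]
  calc ‖F (g + (s : 𝕜) • banachAdjoint Z g)‖ ≤ ‖F‖ * ((1 + c * s ^ 2) * ‖g‖) :=
        F.le_opNorm_of_le (h1 g)
    _ = (1 + c * s ^ 2) * ‖F‖ * ‖g‖ := by ring

/-- If `n(X) > 0`, then an operator on `X*` whose adjoint leaves `X` invariant vanishes as soon as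
its numerical range on the states of `X` is zero. -/
theorem eq_zero_of_forall_numericalStates [CompleteSpace X] (hn : 0 < numericalIndex 𝕜 X)
    {Z : StrongDual 𝕜 X →L[𝕜] StrongDual 𝕜 X}
    (hZ : ∀ p ∈ numericalStates 𝕜 X, Z p.1 p.2 = 0)
    (hZX : ∀ x, ∃ x', NormedSpace.inclusionInDoubleDual 𝕜 X x'
      = banachAdjoint Z (NormedSpace.inclusionInDoubleDual 𝕜 X x)) : Z = 0 := by
  choose b hb using hZX
  have hb' : ∀ (g : StrongDual 𝕜 X) (x : X), g (b x) = Z g x := fun g x =>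
    congrArg (fun F : StrongDual 𝕜 (StrongDual 𝕜 X) => F g) (hb x)
  let B : X →L[𝕜] X := LinearMap.mkContinuous
    { toFun := b
      map_add' := fun x x' => by
        refine (SeparatingDual.eq_iff_forall_dual_eq (R := 𝕜)).mpr fun g => ?_
        rw [map_add, hb', hb', hb', map_add]
      map_smul' := fun c x => by
        refine (SeparatingDual.eq_iff_forall_dual_eq (R := 𝕜)).mpr fun g => ?_
        rw [RingHom.id_apply, map_smul, hb', hb', map_smul] } ‖Z‖ fun x => by
      change ‖b x‖ ≤ _
      rw [← norm_inclusionInDoubleDual (𝕜 := 𝕜) (b x), hb, ← norm_inclusionInDoubleDual (𝕜 := 𝕜) x]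
      exact ContinuousLinearMap.le_of_opNorm_le _ (norm_banachAdjoint_le Z) _
  have hB : ∀ (g : StrongDual 𝕜 X) (x : X), g (B x) = Z g x := hb'
  have hv : numericalRadius B ≤ 0 := numericalRadius_le _ le_rfl fun p hp => by
    rw [hB, hZ p hp, norm_zero]
  have hnorm : ‖B‖ ≤ 0 := by
    have h1 := NumRadOp.mul_opNorm_le_norm ((NumRadOp.toOp 𝕜 X).symm B)
    rw [NumRadOp.norm_def, LinearEquiv.apply_symm_apply] at h1
    exact le_of_mul_le_mul_left ((h1.trans hv).trans_eq (mul_zero _).symm) hn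
  have hB0 : B = 0 := norm_le_zero_iff.mp hnorm
  ext g x
  rw [← hB, hB0]
  exact map_zero g

end Adjoint

namespace NumRadOp

variable {𝕜 : Type*} [RCLike 𝕜] {X : Type*} [NormedAddCommGroup X] [NormedSpace 𝕜 X]

set_option maxHeartbeats 400000 in
/-- The map `M : X* → X***` is the canonical embedding: at the identity, the functional `x** ⊗ x*`
is carried by the compact operators alone. -/
theorem compactPartAtOne_eq_inclusion [CompleteSpace X] [Nontrivial X]
    {hn : 0 < numericalIndex 𝕜 X}
    {P : StrongDual 𝕜 (NumRadOp 𝕜 X) →L[𝕜] StrongDual 𝕜 (NumRadOp 𝕜 X)}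
    (hP : IsDualLProjection P)
    (hJ : LinearMap.range P.toLinearMap = annihilatorInDual (compactOps 𝕜 X))
    (g : StrongDual 𝕜 X) (F : StrongDual 𝕜 (StrongDual 𝕜 X)) :
    compactPartAtOne hn P g F = F g := by
  set M := compactPartAtOne hn P with hMdef
  set p := restrictToPredual 𝕜 X with hp
  set ι := NormedSpace.inclusionInDoubleDual 𝕜 (StrongDual 𝕜 X) with hι
  set Z : StrongDual 𝕜 X →L[𝕜] StrongDual 𝕜 X := 1 - p.comp M with hZdef
  let Mr := M.restrictScalars ℝ
  let pr := p.restrictScalars ℝ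
  let Zr := Z.restrictScalars ℝ
  have hpM : ∀ e, pr (Mr e) = e - Zr e := fun e => (sub_sub_cancel e (p (M e))).symm
  have hZstate : ∀ q ∈ numericalStates 𝕜 X, Z q.1 q.2 = 0 := by
    intro q hq
    change q.1 q.2 - M q.1 (NormedSpace.inclusionInDoubleDual 𝕜 X q.2) = 0
    rw [hq.2.2, compactPartAtOne_apply_of_numericalStates hP hJ hq, sub_self]
  have hZacc : ∀ (e : StrongDual 𝕜 X) (s : ℝ), ‖e‖ ≤ ‖e + s • Zr e‖ := by
    intro e s
    refine forall_of_isClosed_of_numericalStates (C := {e | ‖e‖ ≤ ‖e + s • Zr e‖})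
      (isClosed_le (by fun_prop) (by fun_prop)) (fun q hq r hr => ?_) e
    have h1 : (r • q.1 + s • Zr (r • q.1)) q.2 = (r : 𝕜) := by
      rw [map_smul]
      change r • q.1 q.2 + s • r • Z q.1 q.2 = _
      rw [hZstate q hq, hq.2.2, smul_zero, smul_zero, add_zero, RCLike.real_smul_eq_coe_mul,
        mul_one]
    have h2 := (r • q.1 + s • Zr (r • q.1)).le_opNorm q.2
    rw [h1, hq.2.1, mul_one, RCLike.norm_ofReal, abs_of_nonneg hr] at h2
    change ‖r • q.1‖ ≤ _
    rwa [norm_smul, hq.1, mul_one, Real.norm_of_nonneg hr]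
  have hMacc : ∀ (y : StrongDual 𝕜 (StrongDual 𝕜 (StrongDual 𝕜 X))) (s : ℝ), 0 ≤ s →
      ‖y‖ + s * ‖pr y‖ ≤ ‖y + s • Mr (pr y)‖ := by
    intro y s hs
    refine forall_of_isClosed_of_numericalStates
      (C := {y | ‖y‖ + s * ‖pr y‖ ≤ ‖y + s • Mr (pr y)‖})
      (isClosed_le (by fun_prop) (by fun_prop)) (fun q hq r hr => ?_) y
    have h1 : (r • q.1 + s • Mr (pr (r • q.1))) q.2
        = ((r : ℝ) : 𝕜) + ((s * r : ℝ) : 𝕜) * M (p q.1) q.2 := by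
      rw [map_smul, map_smul]
      change r • q.1 q.2 + s • r • M (p q.1) q.2 = _
      rw [hq.2.2, smul_smul, RCLike.real_smul_eq_coe_mul, RCLike.real_smul_eq_coe_mul, mul_one]
    have h2 := (r • q.1 + s • Mr (pr (r • q.1))).le_opNorm q.2
    rw [hq.2.1, mul_one] at h2
    have h3 := norm_restrictToPredual_le_re_compactPartAtOne (hn := hn) hP hJ hq
    have h4 := (RCLike.re_le_norm _).trans h2
    rw [h1, map_add, RCLike.ofReal_re, RCLike.re_ofReal_mul] at h4
    have h5 := mul_le_mul_of_nonneg_left h3 (mul_nonneg hs hr)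
    change ‖r • q.1‖ + s * ‖pr (r • q.1)‖ ≤ _
    rw [map_smul, norm_smul, norm_smul, hq.1, mul_one, Real.norm_of_nonneg hr, ← mul_assoc]
    exact (add_le_add le_rfl h5).trans h4
  have hflow : ∀ y w, pr y = w - Zr w → ‖y - Mr w‖ + ‖pr y‖ ≤ ‖y‖ := fun y w hyw =>
    norm_sub_add_norm_le_of_accretive hMacc hpM hZacc hyw
  -- Starting from `y ∈ X*`, all of the norm of `y` is used up, so the limit is zero.
  have hMι : ∀ w, M w = ι (w - Z w) := by
    intro w
    have h1 := hflow (ι (w - Z w)) w rfl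
    have h2 : ‖ι (w - Z w)‖ = ‖w - Z w‖ := norm_inclusionInDoubleDual (𝕜 := 𝕜) _
    have h3 : ‖ι (w - Z w) - M w‖ ≤ 0 := by
      change ‖ι (w - Z w) - M w‖ + ‖w - Z w‖ ≤ _ at h1
      linarith
    exact (sub_eq_zero.mp (norm_le_zero_iff.mp h3)).symm
  have hsum : ∀ y, ‖y - (ι.restrictScalars ℝ) (pr y)‖ + ‖pr y‖ ≤ ‖y‖ := by
    intro y
    obtain ⟨w, hw⟩ := exists_sub_eq_of_accretive hZacc (pr y)
    have h1 := hflow y w hw.symm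
    have h2 : Mr w = (ι.restrictScalars ℝ) (pr y) := by
      rw [← hw]; exact hMι w
    rwa [h2] at h1
  have hW : ∀ (y : StrongDual 𝕜 (StrongDual 𝕜 (StrongDual 𝕜 X))) (s : ℝ),
      ‖y + s • ((banachAdjoint (banachAdjoint Z)).restrictScalars ℝ) y‖
        ≤ (1 + ‖Zr‖ ^ 2 * s ^ 2) * ‖y‖ :=
    norm_add_smul_banachAdjoint_banachAdjoint_le (by positivity) fun e s => by
      have := norm_add_smul_le_of_accretive hZacc e s
      rwa [RCLike.real_smul_eq_coe_smul (K := 𝕜)] at this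
  have hZ0 : Z = 0 := by
    refine eq_zero_of_forall_numericalStates hn hZstate fun x => ?_
    refine exists_inclusion_eq_of_forall_apply_eq_zero fun ν hν => ?_
    have h1 := apply_eq_zero_of_lsum (ι := ι.restrictScalars ℝ) (p := pr) (fun e => rfl) hsum
      (by positivity) hW hν
    exact congrArg (fun e : StrongDual 𝕜 X => e x) h1
  rw [hMι, hZ0]
  change F (g - 0) = F g
  rw [sub_zero]

end NumRadOp

/-! ### Limits of states -/

/-- The Banach–Alaoglu theorem for sequences along an ultrafilter. -/
theorem exists_tendsto_of_norm_le {𝕜 : Type*} [RCLike 𝕜] {V : Type*}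
    [SeminormedAddCommGroup V] [NormedSpace 𝕜 V] (𝒰 : Ultrafilter ℕ) (φ : ℕ → StrongDual 𝕜 V)
    {C : ℝ} (hC : 0 ≤ C) (hφ : ∀ n, ‖φ n‖ ≤ C) :
    ∃ ψ : StrongDual 𝕜 V, ‖ψ‖ ≤ C ∧ ∀ v, Tendsto (fun n => φ n v) 𝒰 (𝓝 (ψ v)) := by
  have hlim : ∀ v, ∃ a ∈ closedBall (0 : 𝕜) (C * ‖v‖), Tendsto (fun n => φ n v) 𝒰 (𝓝 a) := by
    intro v
    refine (isCompact_closedBall (0 : 𝕜) (C * ‖v‖)).ultrafilter_le_nhds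
      (𝒰.map fun n => φ n v) (le_principal_iff.mpr (mem_map.mpr (univ_mem' fun n => ?_)))
    rw [mem_preimage, mem_closedBall_zero_iff]
    exact ContinuousLinearMap.le_of_opNorm_le _ (hφ n) v
  choose a ha hlim using hlim
  refine ⟨LinearMap.mkContinuous
    { toFun := a
      map_add' := fun v w => tendsto_nhds_unique (hlim (v + w)) (by
        simpa only [map_add] using (hlim v).add (hlim w))
      map_smul' := fun c v => tendsto_nhds_unique (hlim (c • v)) (by
        simpa only [map_smul, RingHom.id_apply] using (hlim v).const_smul c) } C fun v => ?_,
    LinearMap.mkContinuous_norm_le _ hC _, hlim⟩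
  exact mem_closedBall_zero_iff.mp (ha v)

namespace NumRadOp

variable {𝕜 : Type*} [RCLike 𝕜] {X : Type*} [NormedAddCommGroup X] [NormedSpace 𝕜 X]

/-- Along an ultrafilter, a sequence of states converges on the compact operators to the functional
of a pair `(x*, x**)`, although not on all operators. -/
theorem tendsto_apply_of_isCompactOperator {𝒰 : Ultrafilter ℕ} {u : ℕ → StrongDual 𝕜 X × X}
    (hu : ∀ n, u n ∈ numericalStates 𝕜 X) {g : StrongDual 𝕜 X}
    (hg : ∀ x, Tendsto (fun n => (u n).1 x) 𝒰 (𝓝 (g x))) {F : StrongDual 𝕜 (StrongDual 𝕜 X)}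
    (hF : ∀ h : StrongDual 𝕜 X, Tendsto (fun n => h (u n).2) 𝒰 (𝓝 (F h))) {K : X →L[𝕜] X}
    (hK : IsCompactOperator K) :
    Tendsto (fun n => (u n).1 (K (u n).2)) 𝒰 (𝓝 (F (banachAdjoint K g))) := by
  obtain ⟨V, hV, hKV⟩ := hK.image_closedBall_subset_compact (f := K.toLinearMap) 1
  obtain ⟨k, -, hk⟩ := hV.ultrafilter_le_nhds (𝒰.map fun n => K (u n).2)
    (le_principal_iff.mpr (mem_map.mpr (univ_mem' fun n =>
      hKV ⟨(u n).2, by simp [(hu n).2.1], rfl⟩)))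
  have hk' : Tendsto (fun n => K (u n).2) 𝒰 (𝓝 k) := hk
  have h1 : Tendsto (fun n => (u n).1 (K (u n).2 - k)) 𝒰 (𝓝 0) := by
    refine squeeze_zero_norm (a := fun n => ‖K (u n).2 - k‖) (fun n => ?_)
      (tendsto_iff_norm_sub_tendsto_zero.mp hk')
    simpa [(hu n).1] using (u n).1.le_opNorm (K (u n).2 - k)
  have h2 : F (banachAdjoint K g) = g k :=
    tendsto_nhds_unique (hF (banachAdjoint K g)) ((g.continuous.tendsto k).comp hk')
  have h3 := h1.add (hg k)
  rw [zero_add, ← h2] at h3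
  refine h3.congr fun n => ?_
  rw [map_sub, sub_add_cancel]

theorem exists_seq_numericalStates_tendsto [Nontrivial X] (A : X →L[𝕜] X) :
    ∃ u : ℕ → StrongDual 𝕜 X × X, (∀ n, u n ∈ numericalStates 𝕜 X) ∧
      Tendsto (fun n => ‖(u n).1 (A (u n).2)‖) atTop (𝓝 (numericalRadius A)) := by
  have h : ∀ n : ℕ, ∃ p ∈ numericalStates 𝕜 X,
      numericalRadius A - 1 / ((n : ℝ) + 1) < ‖p.1 (A p.2)‖ := by
    intro n
    obtain ⟨p₀, hp₀⟩ := numericalStates_nonempty 𝕜 X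
    obtain ⟨_, ⟨p, hp, rfl⟩, hlt⟩ := exists_lt_of_lt_csSup
      (s := {r : ℝ | ∃ p ∈ numericalStates 𝕜 X, r = ‖p.1 (A p.2)‖}) ⟨_, p₀, hp₀, rfl⟩
      (show numericalRadius A - 1 / ((n : ℝ) + 1) < numericalRadius A from
        sub_lt_self _ Nat.one_div_pos_of_nat)
    exact ⟨p, hp, hlt⟩
  choose u hu hlt using h
  refine ⟨u, hu, tendsto_of_tendsto_of_tendsto_of_le_of_le (h := fun _ => numericalRadius A) ?_
    tendsto_const_nhds (fun n => (hlt n).le) fun n => norm_apply_le_numericalRadius A (hu n)⟩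
  simpa using (tendsto_const_nhds (x := numericalRadius A)).sub
    (tendsto_one_div_add_atTop_nhds_zero_nat (𝕜 := ℝ))

theorem attainsNumericalRadius_banachAdjoint_of_hasFarthestPoint [CompleteSpace X] [Nontrivial X]
    (hn : 0 < numericalIndex 𝕜 X) (hM : IsMIdeal (compactOps 𝕜 X)) {T : NumRadOp 𝕜 X}
    (hT : HasFarthestPoint T (compactOpsUnitBall 𝕜 X)) :
    AttainsNumericalRadius (banachAdjoint (toOp 𝕜 X T)) := by
  obtain ⟨-, P, hP, hJ⟩ := hM
  obtain ⟨K, hK, hTK⟩ := hT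
  rw [farthestDist_compactOpsUnitBall, norm_def] at hTK
  obtain ⟨u, hu, hlim⟩ := exists_seq_numericalStates_tendsto (toOp 𝕜 X (T - K))
  rw [hTK] at hlim
  let 𝒰 : Ultrafilter ℕ := hyperfilter ℕ
  have h𝒰 : (𝒰 : Filter ℕ) ≤ atTop := Nat.hyperfilter_le_atTop
  choose f hf1 hf using fun n => exists_functional_of_numericalStates (hu n)
  obtain ⟨φ, hφ1, hφ⟩ := exists_tendsto_of_norm_le 𝒰 f zero_le_one hf1
  obtain ⟨g, hg1, hg⟩ := exists_tendsto_of_norm_le 𝒰 (fun n => (u n).1) zero_le_one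
    fun n => (hu n).1.le
  obtain ⟨F, hF1, hF⟩ := exists_tendsto_of_norm_le 𝒰
    (fun n => NormedSpace.inclusionInDoubleDual 𝕜 X (u n).2) zero_le_one
    fun n => (norm_inclusionInDoubleDual _).trans_le (hu n).2.1.le
  have hφJ : ∀ S ∈ compactOps 𝕜 X, φ S = F (banachAdjoint (toOp 𝕜 X S) g) := fun S hS => by
    refine tendsto_nhds_unique (hφ S) ?_
    simp only [hf]
    exact tendsto_apply_of_isCompactOperator hu hg hF hS
  have hφone : φ (one 𝕜 X) = 1 := by
    refine tendsto_nhds_unique (hφ _) (tendsto_const_nhds.congr fun n => ?_)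
    rw [hf]
    exact (hu n).2.2.symm
  have hφTK : ‖φ (T - K)‖ = numericalRadius (toOp 𝕜 X T) + 1 := by
    refine tendsto_nhds_unique (hφ _).norm ((hlim.mono_left h𝒰).congr fun n => ?_)
    rw [hf]
  have hφle : ∀ S, ‖φ S‖ ≤ ‖S‖ := fun S => by
    simpa using ContinuousLinearMap.le_of_opNorm_le _ hφ1 S
  -- `φ` takes extreme values at `T` and at `K`; the latter forces `P φ = 0`.
  have hsum : numericalRadius (toOp 𝕜 X T) + 1 ≤ ‖φ T‖ + ‖φ K‖ := by
    rw [← hφTK, map_sub]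
    exact norm_sub_le _ _
  have hφK : 1 ≤ ‖φ K‖ := by
    have := hφle T
    rw [norm_def] at this
    linarith
  have hφT : numericalRadius (toOp 𝕜 X T) ≤ ‖φ T‖ := by linarith [hφle K, hK.2]
  have hpart : 1 ≤ ‖φ - P φ‖ := by
    have h1 : (φ - P φ) K = φ K := by
      change φ K - P φ K = φ K
      rw [apply_eq_zero_of_range_eq_annihilator hJ φ hK.1, sub_zero]
    refine hφK.trans ?_
    rw [← h1]
    exact ContinuousLinearMap.le_of_opNorm_le_of_le _ le_rfl hK.2 |>.trans_eq (mul_one _)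
  have hzero : ∀ {ψ : StrongDual 𝕜 (NumRadOp 𝕜 X)}, ‖ψ‖ ≤ 1 → φ - P φ = ψ - P ψ →
      ∀ S, P ψ S = 0 := by
    intro ψ hψ h S
    have h1 : ‖P ψ‖ ≤ 0 := by
      have := hP.norm_eq ψ
      rw [← h] at this
      linarith
    have h2 := ContinuousLinearMap.le_of_opNorm_le _ h1 S
    rw [zero_mul] at h2
    exact norm_le_zero_iff.mp h2
  have hFg : F g = 1 := by
    rw [← compactPartAtOne_eq_inclusion (hn := hn) hP hJ g F,
      compactPartAtOne_eq_of_eqOn hP hJ hφJ]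
    change φ (one 𝕜 X) - P φ (one 𝕜 X) = 1
    rw [hzero hφ1 rfl, hφone, sub_zero]
  have hq : (F, g) ∈ numericalStates 𝕜 (StrongDual 𝕜 X) := by
    have h1 : 1 ≤ ‖F‖ * ‖g‖ := by
      rw [← norm_one (α := 𝕜), ← hFg]
      exact F.le_opNorm g
    refine ⟨le_antisymm hF1 ?_, le_antisymm hg1 ?_, hFg⟩
    · exact h1.trans (mul_le_of_le_one_right (norm_nonneg F) hg1)
    · exact h1.trans (mul_le_of_le_one_left (norm_nonneg g) hF1)
  have hφT' : φ T = F (banachAdjoint (toOp 𝕜 X T) g) := by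
    have h1 : ‖tensor hn g F‖ ≤ 1 :=
      ContinuousLinearMap.opNorm_le_bound _ zero_le_one fun S => by
        rw [one_mul, tensor_apply]
        exact norm_apply_banachAdjoint_le hq _
    have h2 : φ - P φ = tensor hn g F - P (tensor hn g F) :=
      hP.sub_apply_eq_of_eqOn hJ hφJ
    have h3 : φ T - P φ T = tensor hn g F T - P (tensor hn g F) T :=
      congrArg (fun ψ : StrongDual 𝕜 (NumRadOp 𝕜 X) => ψ T) h2
    rwa [hzero hφ1 rfl, hzero h1 h2, sub_zero, sub_zero] at h3
  refine ⟨(F, g), hq, ?_⟩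
  rw [numericalRadius_banachAdjoint, ← hφT']
  exact le_antisymm (hφle T) hφT

end NumRadOp

end

theorem mainTheorem4 {𝕜 : Type*} [RCLike 𝕜] {X : Type*} [NormedAddCommGroup X] [NormedSpace 𝕜 X]
    [CompleteSpace X] [Nontrivial X] (hn : 0 < numericalIndex 𝕜 X) :
    (∀ T : NumRadOp 𝕜 X,
      farthestDist T (compactOpsUnitBall 𝕜 X) = numericalRadius (NumRadOp.toOp 𝕜 X T) + 1) ∧
    (∀ T : NumRadOp 𝕜 X,
      AttainsNumericalRadius (NumRadOp.toOp 𝕜 X T) →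
        HasFarthestPoint T (compactOpsUnitBall 𝕜 X)) ∧
    (IsMIdeal (NumRadOp.compactOps 𝕜 X) →
      ∀ T : NumRadOp 𝕜 X,
        HasFarthestPoint T (compactOpsUnitBall 𝕜 X) →
          AttainsNumericalRadius (banachAdjoint (NumRadOp.toOp 𝕜 X T))) := by
  exact ⟨NumRadOp.farthestDist_compactOpsUnitBall,
    fun _ hT => NumRadOp.hasFarthestPoint_of_attainsNumericalRadius hT,
    fun hM _ hT =>
      NumRadOp.attainsNumericalRadius_banachAdjoint_of_hasFarthestPoint hn hM hT⟩
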